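/- For a finite complex-valued Borel measure $\mu$ on $\mathbb{R}^2$ put $$\hat\mu(\xi)=\int_{\mathbb{R}^2} e^{i\pi\langle x,\xi\rangle}\,d\mu(x),\qquad \xi\in\mathbb{R}^2,\quad \langle x,\xi\rangle=x_1\xi_1+x_2\xi_2 .$$ Fix real numbers $\alpha,\beta,M>0$. Let $$\Gamma_M=\Big\{x\in\mathbb{R}^2:\ x_1x_2=\frac{M^2}{4\pi^2}\Big\},\qquad \Gamma_M^+=\Gamma_M\cap(\mathbb{R}_+\times\mathbb{R}_+),\qquad \Gamma_M^-=\Gamma_M\setminus\Gamma_M^+,$$ where $\mathbb{R}_+=\{t\in\mathbb{R}: t>0\}$, and let $\Lambda_{\alpha,\beta}=(\alpha\mathbb{Z}\times\{0\})\cup(\{0\}\times\beta\mathbb{Z})$ be the lattice-cross. Let $\mathrm{AC}(\Gamma_M,\Lambda_{\alpha,\beta})$ be the set of all finite complex-valued Borel measures $\mu$ on $\mathbb{R}^2$ that are supported on $\Gamma_M$, are absolutely continuous with respect to arc length measure on $\Gamma_M$, and satisfy $\hat\mu(\xi)=0$ for every $\xi\in\Lambda_{\alpha,\beta}$. Then every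 $\mu\in\mathrm{AC}(\Gamma_M,\Lambda_{\alpha,\beta})$ is uniquely determined within $\mathrm{AC}(\Gamma_M,\Lambda_{\alpha,\beta})$ by its restriction to $\Gamma_M^-$ (that is, $\mu,\nu\in\mathrm{AC}(\Gamma_M,\Lambda_{\alpha,\beta})$ and $\mu|_{\Gamma_M^-}=\nu|_{\Gamma_M^-}$ imply $\mu=\nu$) if and only if $\alpha\beta M^2<16\pi^2$. Likewise, every $\mu\in\mathrm{AC}(\Gamma_M,\Lambda_{\alpha,\beta})$ is uniquely determined within $\mathrm{AC}(\Gamma_M,\Lambda_{\alpha,\beta})$ by its restriction to $\Gamma_M^+$ if and only if $\alpha\beta M^2<16\pi^2$. -/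

import Mathlib

open MeasureTheory
open scoped MeasureTheory

namespace KleinGordon

/-- The Euclidean plane `ℝ²`, with coordinates `x 0`, `x 1`. -/
abbrev Plane : Type := EuclideanSpace ℝ (Fin 2)

/-- The Fourier transform `μ̂(ξ) = ∫ exp(iπ⟨x, ξ⟩) dμ(x)` of a finite complex Borel measure in the
plane. -/
noncomputable def measureFourier (μ : ComplexMeasure Plane) (ξ : Plane) : ℂ :=
  ∫ᵛ x : Plane, Complex.exp (Complex.I * (Real.pi : ℂ) * ((inner ℝ x ξ : ℝ) : ℂ))
    ∂[ContinuousLinearMap.mul ℝ ℂ; μ]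

/-- Arc length measure on a curve `Γ` in the plane: the one-dimensional Hausdorff measure of the
Euclidean metric, restricted to `Γ`. -/
noncomputable def arcLength (Γ : Set Plane) : Measure Plane :=
  (Measure.hausdorffMeasure 1).restrict Γ

/-- `M(Γ)`: the finite complex Borel measures in the plane which are supported on `Γ`. -/
def measuresOn (Γ : Set Plane) : Set (ComplexMeasure Plane) :=
  {μ | ∀ s : Set Plane, MeasurableSet s → Disjoint s Γ → μ s = 0}

/-- `AC(Γ)`: the measures in `M(Γ)` which are absolutely continuous with respect to arc length
measure on `Γ`. -/
def AC (Γ : Set Plane) : Set (ComplexMeasure Plane) :=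
  {μ | μ ∈ measuresOn Γ ∧ ∀ s : Set Plane, MeasurableSet s → arcLength Γ s = 0 → μ s = 0}

/-- `AC(Γ, Λ)`: the measures in `AC(Γ)` whose Fourier transform vanishes on `Λ`. -/
def ACVanishing (Γ Λ : Set Plane) : Set (ComplexMeasure Plane) :=
  {μ | μ ∈ AC Γ ∧ ∀ ξ ∈ Λ, measureFourier μ ξ = 0}

/-- The hyperbola `Γ_M = {x ∈ ℝ² : x₁ x₂ = M² / (4π²)}`. -/
def hyperbola (M : ℝ) : Set Plane :=
  {x | x 0 * x 1 = M ^ 2 / (4 * Real.pi ^ 2)}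

/-- The branch `Γ_M⁺ = Γ_M ∩ (ℝ₊ × ℝ₊)`. -/
def hyperbolaPos (M : ℝ) : Set Plane :=
  hyperbola M ∩ {x | 0 < x 0 ∧ 0 < x 1}

/-- The complementary branch `Γ_M⁻ = Γ_M \ Γ_M⁺`. -/
def hyperbolaNeg (M : ℝ) : Set Plane :=
  hyperbola M \ hyperbolaPos M

/-- The lattice-cross `Λ_{α,β} = (αℤ × {0}) ∪ ({0} × βℤ)`. -/
def latticeCross (α β : ℝ) : Set Plane :=
  {ξ | (∃ m : ℤ, ξ 0 = α * m) ∧ ξ 1 = 0} ∪ {ξ | ξ 0 = 0 ∧ ∃ n : ℤ, ξ 1 = β * n}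

theorem measurableSet_hyperbola (M : ℝ) : MeasurableSet (hyperbola M) := by
  unfold hyperbola
  exact measurableSet_eq_fun (by fun_prop) measurable_const

/-- The two branches are Borel sets, so that `VectorMeasure.restrict` to a branch is the genuine
restriction `s ↦ μ (s ∩ Γ_M^±)` of a measure. -/
theorem measurableSet_hyperbolaPos (M : ℝ) : MeasurableSet (hyperbolaPos M) := by
  unfold hyperbolaPos
  refine (measurableSet_hyperbola M).inter ?_
  have h0 : Measurable fun x : Plane => x 0 := by fun_prop
  have h1 : Measurable fun x : Plane => x 1 := by fun_prop
  exact (measurableSet_lt measurable_const h0).inter (measurableSet_lt measurable_const h1)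

theorem measurableSet_hyperbolaNeg (M : ℝ) : MeasurableSet (hyperbolaNeg M) :=
  (measurableSet_hyperbola M).diff (measurableSet_hyperbolaPos M)

end KleinGordon

open Set Filter Topology
open scoped ENNReal

namespace KleinGordon

/-! By linearity, being determined on one branch means that no nonzero admissible measure is carried
by the other branch. A branch with sign `ε` is parametrized by `s > 0` through `ε(2s/α, 2γ/(βs))`,
where `γ = αβM²/(16π²)`. The characters of the lattice-cross become `exp(2πiεms)` and
`exp(2πiεnγ/s)`. The question is thus whether a nonzero absolutely continuous measure on the
half-line can vanish modulo 1 in both coordinates `s` and `γ/s`. The threshold is `γ = 1`.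

For `γ < 1`, split a real measure into its Jordan parts with densities `f`, `g`. Their
periodizations agree and `f g = 0`, so on `(0, 1]` the density `F = f + g` is at most the sum of its
positive integer translates. The same holds for the inverted density, hence for their sum `H`, which
is invariant under `u ↦ γ/u`. Inversion sends `(1, ∞)` to `(0, γ)`, a proper part of `(0, 1]`.
Comparing `H` with multiples of the weight `1/(γ + x)` gives a strict contraction, which forces `H =
0` (`lintegral_sub_weight_le`, `ae_eq_zero_of_le_translateSum`).

For `γ ≥ 1`, start from a density on `(0, 1]` and cancel it modulo 1 in the coordinate `γ/s` by a
density on `(1, ∞)`, which is possible because `(γ - 1, γ]` is a full period inside the half-line.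
Folding the result back to `(0, 1]` by integer translations defines a mass-preserving transfer
operator. A fixed point of it yields a nonzero solution. One is obtained as the lower limit of the
iterates of the constant 1, which stay decreasing and uniformly bounded (`exists_bound_transferOp`,
`exists_invariant_density`). -/

/-! ### Periodization and inversion of densities on the half-line -/

/-- The sum of the translates of `F` by the positive integers. -/
noncomputable def translateSum (F : ℝ → ℝ≥0∞) (x : ℝ) : ℝ≥0∞ :=
  ∑' k : ℕ, F (x + ((k : ℝ) + 1))

/-- The density, in the coordinate `u = γ / x`, of the measure with density `F` in the
coordinate `x`. -/
noncomputable def invDensity (γ : ℝ) (F : ℝ → ℝ≥0∞) (u : ℝ) : ℝ≥0∞ :=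
  ENNReal.ofReal (γ / u ^ 2) * F (γ / u)

theorem measurable_translateSum {F : ℝ → ℝ≥0∞} (hF : Measurable F) :
    Measurable (translateSum F) := by
  unfold translateSum
  fun_prop

theorem measurable_invDensity (γ : ℝ) {F : ℝ → ℝ≥0∞} (hF : Measurable F) :
    Measurable (invDensity γ F) := by
  unfold invDensity
  fun_prop

theorem setLIntegral_comp_add_right (F : ℝ → ℝ≥0∞) (a b c : ℝ) :
    ∫⁻ x in Ioc a b, F (x + c) = ∫⁻ x in Ioc (a + c) (b + c), F x := by
  rw [← lintegral_indicator measurableSet_Ioc, ← lintegral_indicator measurableSet_Ioc,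
    
    ← lintegral_add_right_eq_self ((Ioc (a + c) (b + c)).indicator F) c]
  congr 1 with x
  simp [indicator]

theorem Ioi_eq_iUnion_Ioc (a : ℝ) :
    Ioi (a + 1) = ⋃ k : ℕ, Ioc (a + ((k : ℝ) + 1)) (a + 1 + ((k : ℝ) + 1)) := by
  ext x
  simp only [mem_Ioi, mem_iUnion, mem_Ioc]
  constructor
  · intro hx
    have h0 : (0 : ℝ) < x - (a + 1) := by linarith
    have h1 : 0 < ⌈x - (a + 1)⌉₊ := Nat.ceil_pos.2 h0
    refine ⟨⌈x - (a + 1)⌉₊ - 1, ?_, ?_⟩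
    · have := Nat.ceil_lt_add_one h0.le
      rw [Nat.cast_sub h1]; push_cast; linarith
    · have := Nat.le_ceil (x - (a + 1))
      rw [Nat.cast_sub h1]; push_cast; linarith
  · rintro ⟨k, hk, -⟩
    have : (0 : ℝ) ≤ k := k.cast_nonneg
    linarith

theorem pairwise_disjoint_Ioc_translates (a : ℝ) : Pairwise (Function.onFun Disjoint
    fun k : ℕ => Ioc (a + ((k : ℝ) + 1)) (a + 1 + ((k : ℝ) + 1))) := by
  intro i j hij
  rw [Function.onFun, Set.disjoint_left]
  rintro x ⟨h1, h2⟩ ⟨h3, h4⟩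
  apply hij
  have h5 : (i : ℝ) < (j : ℝ) + 1 := by linarith
  have h6 : (j : ℝ) < (i : ℝ) + 1 := by linarith
  norm_cast at h5 h6
  omega

/-- Unfolding: the integral of the sum of translates over a unit interval. -/
theorem setLIntegral_translateSum {F : ℝ → ℝ≥0∞} (hF : Measurable F) (a : ℝ) :
    ∫⁻ x in Ioc a (a + 1), translateSum F x = ∫⁻ x in Ioi (a + 1), F x := by
  unfold translateSum
  rw [lintegral_tsum (fun k => by fun_prop), Ioi_eq_iUnion_Ioc,
    lintegral_iUnion (fun k => measurableSet_Ioc) (pairwise_disjoint_Ioc_translates a)]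
  exact tsum_congr fun k => setLIntegral_comp_add_right F _ _ _

/-- Change of variables `x = γ / u` on a subset of the positive half-line. -/
theorem setLIntegral_invDensity {γ : ℝ} (hγ : 0 < γ) (F : ℝ → ℝ≥0∞) {s t : Set ℝ}
    (hs : MeasurableSet s) (hs0 : s ⊆ Ioi 0) (ht0 : t ⊆ Ioi 0)
    (hst : ∀ u, 0 < u → (u ∈ s ↔ γ / u ∈ t)) :
    ∫⁻ u in s, invDensity γ F u = ∫⁻ x in t, F x := by
  have himg : t = (fun u => γ / u) '' s := by
    ext x
    constructor
    · intro hx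
      have hx0 : 0 < x := ht0 hx
      refine ⟨γ / x, (hst _ (div_pos hγ hx0)).2 ?_, ?_⟩
      · rwa [div_div_cancel₀ hγ.ne']
      · exact div_div_cancel₀ hγ.ne'
    · rintro ⟨u, hu, rfl⟩
      exact (hst u (hs0 hu)).1 hu
  rw [himg, lintegral_image_eq_lintegral_abs_deriv_mul (f' := fun u => -γ / u ^ 2) hs]
  · refine setLIntegral_congr_fun hs fun u hu => ?_
    have hu0 : 0 < u := hs0 hu
    simp only [invDensity]
    rw [neg_div, abs_neg, abs_of_pos (by positivity)]
  · intro u hu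
    have hu0 : u ≠ 0 := (hs0 hu : 0 < u).ne'
    have := ((hasDerivAt_const u γ).fun_div (hasDerivAt_id u) hu0).hasDerivWithinAt (s := s)
    simpa using this
  · intro u hu v hv h
    have hu0 : 0 < u := hs0 hu
    have hv0 : 0 < v := hs0 hv
    simp only at h
    field_simp at h
    exact h.symm

theorem invDensity_invDensity {γ : ℝ} (hγ : 0 < γ) (F : ℝ → ℝ≥0∞) {u : ℝ} (hu : 0 < u) :
    invDensity γ (invDensity γ F) u = F u := by
  simp only [invDensity]
  rw [← mul_assoc, ← ENNReal.ofReal_mul (by positivity), div_div_cancel₀ hγ.ne']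
  have : γ / u ^ 2 * (γ / (γ / u) ^ 2) = 1 := by field_simp
  simp [this]

theorem setLIntegral_Ioi_one_invDensity {γ : ℝ} (hγ : 0 < γ) (F : ℝ → ℝ≥0∞) :
    ∫⁻ y in Ioi 1, invDensity γ F y = ∫⁻ u in Ioo 0 γ, F u := by
  refine setLIntegral_invDensity hγ F measurableSet_Ioi (Ioi_subset_Ioi zero_le_one)
    (fun x hx => hx.1) fun u hu => ?_
  simp only [mem_Ioi, mem_Ioo, div_pos hγ hu, true_and]
  rw [div_lt_iff₀ hu, lt_mul_iff_one_lt_right hγ]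

theorem setLIntegral_Ioi_self_invDensity {γ : ℝ} (hγ : 0 < γ) (F : ℝ → ℝ≥0∞) :
    ∫⁻ u in Ioi γ, invDensity γ F u = ∫⁻ x in Ioc 0 1, F x := by
  rw [setLIntegral_invDensity hγ F (t := Ioo 0 1) measurableSet_Ioi (Ioi_subset_Ioi hγ.le)
    (fun x hx => hx.1) fun u hu => ?_]
  · exact setLIntegral_congr Ioo_ae_eq_Ioc
  · simp only [mem_Ioi, mem_Ioo, div_pos hγ hu, true_and]
    rw [div_lt_one hu]

theorem setLIntegral_Ioi_zero_invDensity {γ : ℝ} (hγ : 0 < γ) (F : ℝ → ℝ≥0∞) :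
    ∫⁻ u in Ioi 0, invDensity γ F u = ∫⁻ x in Ioi 0, F x :=
  setLIntegral_invDensity hγ F measurableSet_Ioi subset_rfl subset_rfl fun u hu => by
    simp only [mem_Ioi, hu, div_pos hγ hu]

/-! ### The contraction for `γ < 1` -/

/-- Telescoping: the translates of `y ↦ 1 / (y (y + 1))` sum to `1 / (x + 1)`. -/
theorem translateSum_inv_mul_succ {x : ℝ} (hx : 0 ≤ x) :
    translateSum (fun y => ENNReal.ofReal (1 / (y * (y + 1)))) x = ENNReal.ofReal (1 / (x + 1)) := by
  have hs : HasSum (fun k : ℕ => 1 / ((x + ((k : ℝ) + 1)) * (x + ((k : ℝ) + 1) + 1)))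
      (1 / (x + 1)) := by
    rw [hasSum_iff_tendsto_nat_of_nonneg (fun k => by positivity)]
    have hsum : ∀ n : ℕ, ∑ k ∈ Finset.range n,
        1 / ((x + ((k : ℝ) + 1)) * (x + ((k : ℝ) + 1) + 1)) = 1 / (x + 1) - 1 / (x + 1 + n) := by
      intro n
      induction n with
      | zero => simp
      | succ n ih =>
        rw [Finset.sum_range_succ, ih]
        push_cast
        field_simp
        ring
    simp_rw [hsum]
    have : Tendsto (fun n : ℕ => 1 / (x + 1 + (n : ℝ))) atTop (𝓝 0) :=
      (tendsto_atTop_add_const_left _ _ tendsto_natCast_atTop_atTop).const_div_atTop 1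
    simpa using tendsto_const_nhds.sub this
  unfold translateSum
  rw [← hs.tsum_eq, ENNReal.ofReal_tsum_of_nonneg (fun k => by positivity) hs.summable]

/-- One step of the contraction: raising the level by the factor `κ⁻¹` does not decrease the
integral of the excess over a multiple of the weight `1 / (γ + x)`. -/
theorem lintegral_sub_weight_le {γ κ : ℝ} (hγ : 0 < γ) (hγ1 : γ < 1)
    (hκ : κ = (γ + 1) / 2) {H : ℝ → ℝ≥0∞} (hH : Measurable H)
    (hinv : ∀ u, 0 < u → invDensity γ H u = H u)
    (hle : ∀ᵐ x ∂volume.restrict (Ioc (0 : ℝ) 1), H x ≤ translateSum H x) {N : ℝ} (hN : 0 ≤ N) :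
    ∫⁻ x in Ioc 0 1, (H x - ENNReal.ofReal (κ * N / (γ + x))) ≤
      ∫⁻ x in Ioc 0 1, (H x - ENNReal.ofReal (N / (γ + x))) := by
  -- The subtracted weight is chosen for two properties: its translates telescope to `1 / (x + 1)`,
  -- and inversion turns it into exactly `1 / (γ + u)`.
  set G : ℝ → ℝ≥0∞ := fun y => H y - ENNReal.ofReal N * ENNReal.ofReal (1 / (y * (y + 1)))
  have hG : Measurable G := by fun_prop
  calc ∫⁻ x in Ioc 0 1, (H x - ENNReal.ofReal (κ * N / (γ + x)))
      ≤ ∫⁻ x in Ioc 0 1, translateSum G x := by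
        refine lintegral_mono_ae ?_
        filter_upwards [hle, ae_restrict_mem measurableSet_Ioc] with x hx hx01
        rw [tsub_le_iff_right]
        have h1 : translateSum H x ≤ translateSum G x + ENNReal.ofReal N *
            translateSum (fun y => ENNReal.ofReal (1 / (y * (y + 1)))) x := by
          unfold translateSum
          rw [← ENNReal.tsum_mul_left, ← ENNReal.tsum_add]
          exact ENNReal.tsum_le_tsum fun k => le_tsub_add
        refine hx.trans (h1.trans ?_)
        gcongr
        rw [translateSum_inv_mul_succ hx01.1.le, ← ENNReal.ofReal_mul hN]
        apply ENNReal.ofReal_le_ofReal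
        have hx0 := hx01.1
        -- `κ` is the maximum of `(γ + x) / (1 + x)` on `[0, 1]`, attained at `x = 1`; it is below 1
        -- because `γ < 1`.
        rw [hκ, mul_one_div, div_le_div_iff₀ (by linarith) (by linarith)]
        nlinarith [mul_nonneg hN (sub_nonneg.2 hγ1.le), mul_nonneg hN (mul_nonneg (sub_nonneg.2 hγ1.le)
          (sub_nonneg.2 hx01.2))]
    _ = ∫⁻ u in Ioo 0 γ, invDensity γ G u := by
        have := setLIntegral_translateSum hG 0
        rw [zero_add] at this
        rw [this, ← setLIntegral_Ioi_one_invDensity hγ]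
        exact setLIntegral_congr_fun measurableSet_Ioi fun y hy =>
          (invDensity_invDensity hγ G (zero_lt_one.trans hy)).symm
    _ = ∫⁻ u in Ioo 0 γ, (H u - ENNReal.ofReal (N / (γ + u))) := by
        refine setLIntegral_congr_fun measurableSet_Ioo fun u hu => ?_
        have hu0 := hu.1
        simp only [invDensity, G]
        rw [ENNReal.mul_sub (fun _ _ => ENNReal.ofReal_ne_top)]
        congr 1
        · exact hinv u hu0
        · rw [← ENNReal.ofReal_mul hN, ← ENNReal.ofReal_mul (by positivity)]
          congr 1
          field_simp
    _ ≤ ∫⁻ x in Ioc 0 1, (H x - ENNReal.ofReal (N / (γ + x))) :=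
        lintegral_mono_set fun u hu => ⟨hu.1, hu.2.le.trans hγ1.le⟩

/-- An integrable density which is invariant under the inversion `u ↦ γ / u`, `γ < 1`, and is
dominated on `(0, 1]` by the sum of its translates, vanishes on `(0, 1]`. -/
theorem ae_eq_zero_of_le_translateSum {γ : ℝ} (hγ : 0 < γ) (hγ1 : γ < 1) {H : ℝ → ℝ≥0∞}
    (hH : Measurable H) (hfin : ∫⁻ x in Ioc 0 1, H x ≠ ∞)
    (hinv : ∀ u, 0 < u → invDensity γ H u = H u)
    (hle : ∀ᵐ x ∂volume.restrict (Ioc (0 : ℝ) 1), H x ≤ translateSum H x) :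
    ∀ᵐ x ∂volume.restrict (Ioc (0 : ℝ) 1), H x = 0 := by
  set κ : ℝ := (γ + 1) / 2 with hκ
  have hκ0 : 0 < κ := by positivity
  have hκ1 : κ < 1 := by rw [hκ]; linarith
  set Φ : ℝ → ℝ≥0∞ := fun N => ∫⁻ x in Ioc 0 1, (H x - ENNReal.ofReal (N / (γ + x))) with hΦ
  have hstep : ∀ (N : ℝ), 0 ≤ N → ∀ n : ℕ, Φ N ≤ Φ (N / κ ^ n) := by
    intro N hN n
    induction n with
    | zero => simp
    | succ n ih =>
      refine ih.trans ?_
      have := lintegral_sub_weight_le hγ hγ1 hκ hH hinv hle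
        (N := N / κ ^ (n + 1)) (by positivity)
      rwa [show κ * (N / κ ^ (n + 1)) = N / κ ^ n by rw [pow_succ]; field_simp] at this
  -- The levels grow like `κ⁻ⁿ`, so the excess over them tends to 0 almost everywhere, dominated by
  -- the integrable `H`.
  have hlim : ∀ N : ℝ, 0 < N → Tendsto (fun n : ℕ => Φ (N / κ ^ n)) atTop (𝓝 0) := by
    intro N hN
    rw [show (0 : ℝ≥0∞) = ∫⁻ x in Ioc (0 : ℝ) 1, 0 by simp]
    refine tendsto_lintegral_of_dominated_convergence H (fun n => by fun_prop)
      (fun n => ae_of_all _ fun x => tsub_le_self) hfin ?_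
    filter_upwards [ae_lt_top hH hfin, ae_restrict_mem measurableSet_Ioc] with x hx hx01
    have hx0 := hx01.1
    refine tendsto_const_nhds.congr' ?_
    have ht : Tendsto (fun n : ℕ => N / κ ^ n / (γ + x)) atTop atTop := by
      refine Tendsto.atTop_div_const (by positivity) ?_
      simp_rw [div_eq_mul_inv, ← inv_pow]
      exact (tendsto_pow_atTop_atTop_of_one_lt ((one_lt_inv₀ hκ0).2 hκ1)).const_mul_atTop hN
    filter_upwards [ht.eventually_ge_atTop (H x).toReal] with n hn
    rw [eq_comm, tsub_eq_zero_iff_le]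
    exact (ENNReal.le_ofReal_iff_toReal_le hx.ne (by positivity)).2 hn
  have hzero : ∀ N : ℝ, 0 < N → Φ N = 0 := fun N hN =>
    le_antisymm (ge_of_tendsto' (hlim N hN) (hstep N hN.le)) zero_le
  have hae : ∀ᵐ x ∂volume.restrict (Ioc (0 : ℝ) 1), ∀ n : ℕ,
      H x ≤ ENNReal.ofReal (1 / ((n : ℝ) + 1) / (γ + x)) := by
    rw [ae_all_iff]
    intro n
    have := hzero (1 / ((n : ℝ) + 1)) (by positivity)
    rw [hΦ, lintegral_eq_zero_iff (by fun_prop)] at this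
    filter_upwards [this] with x hx
    exact tsub_eq_zero_iff_le.1 hx
  filter_upwards [hae] with x hx
  have ht := (tendsto_one_div_add_atTop_nhds_zero_nat (𝕜 := ℝ)).div_const (γ + x)
  have ht' := (ENNReal.continuous_ofReal.tendsto _).comp ht
  rw [zero_div, ENNReal.ofReal_zero] at ht'
  exact le_antisymm (ge_of_tendsto' ht' hx) zero_le

/-! ### Fourier coefficients, periodizations and uniqueness on the half-line -/

/-- Two finite measures on the unit circle with the same Fourier coefficients are equal. -/
theorem ext_of_integral_fourier_eq {P Q : Measure UnitAddCircle} [IsFiniteMeasure P]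
    [IsFiniteMeasure Q] (h : ∀ m : ℤ, ∫ z, fourier m z ∂P = ∫ z, fourier m z ∂Q) : P = Q := by
  let A : StarSubalgebra ℂ (BoundedContinuousFunction UnitAddCircle ℂ) :=
    (fourierSubalgebra (T := 1)).comap (BoundedContinuousFunction.toContinuousMapStarₐ ℂ)
  refine ext_of_forall_mem_subalgebra_integral_eq_of_polish (𝕜 := ℂ) (A := A) ?_ ?_
  · intro x y hxy
    obtain ⟨-, ⟨g, hg, rfl⟩, hne⟩ := fourierSubalgebra_separatesPoints (T := 1) hxy
    refine ⟨g, ⟨g, ⟨BoundedContinuousFunction.mkOfCompact g, ?_, ?_⟩, rfl⟩, hne⟩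
    · exact hg
    · ext z; rfl
  · intro g hg
    have hg' : (g : C(UnitAddCircle, ℂ)) ∈
        Submodule.span ℂ (range (@fourier 1)) := by
      rw [← fourierSubalgebra_coe]
      exact hg
    have key : ∀ f ∈ Submodule.span ℂ (range (@fourier 1)),
        ∫ z, f z ∂P = ∫ z, f z ∂Q := by
      intro f hf
      have hint : ∀ (R : Measure UnitAddCircle) [IsFiniteMeasure R] (f : C(UnitAddCircle, ℂ)),
          Integrable f R := fun R _ f => by
        refine Integrable.of_bound f.continuous.aestronglyMeasurable ‖f‖ ?_
        exact ae_of_all _ f.norm_coe_le_norm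
      induction hf using Submodule.span_induction with
      | mem f hf => obtain ⟨m, rfl⟩ := hf; exact h m
      | zero => simp
      | add f g _ _ hf hg =>
        simp only [ContinuousMap.add_apply]
        rw [integral_add (hint P f) (hint P g), integral_add (hint Q f) (hint Q g), hf, hg]
      | smul c f _ hf =>
        simp only [ContinuousMap.smul_apply]
        rw [integral_smul, integral_smul, hf]
    exact key _ hg'

/-- Unfolding over the circle: the integral against a `1`-periodic function. -/
theorem setLIntegral_Ioi_mul_coe_unitAddCircle {f : ℝ → ℝ≥0∞} (hf : Measurable f)
    {e : UnitAddCircle → ℝ≥0∞} (he : Measurable e) (a : ℝ) :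
    ∫⁻ x in Ioi (a + 1), f x * e x = ∫⁻ x in Ioc a (a + 1), translateSum f x * e x := by
  have hec : Measurable fun x : ℝ => e (x : UnitAddCircle) :=
    he.comp AddCircle.measurable_mk'
  rw [← setLIntegral_translateSum (F := fun x => f x * e x) (hf.mul hec)]
  congr 1 with x
  unfold translateSum
  rw [← ENNReal.tsum_mul_right]
  refine tsum_congr fun k => ?_
  have : ((x + ((k : ℝ) + 1) : ℝ) : UnitAddCircle) = x := by
    have h0 : (((k : ℝ) + 1 : ℝ) : UnitAddCircle) = 0 :=
      (AddCircle.coe_eq_zero_iff (1 : ℝ)).2 ⟨k + 1, by simp⟩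
    rw [AddCircle.coe_add, h0, add_zero]
  simp only [this]

/-- Densities on the positive half-line whose measures agree modulo `1` have almost everywhere
equal periodizations. -/
theorem ae_eq_periodization {f g : ℝ → ℝ≥0∞} (hf : Measurable f) (hg : Measurable g)
    (h : ∀ e : UnitAddCircle → ℝ≥0∞, Measurable e →
      ∫⁻ x in Ioi (0 : ℝ), f x * e x = ∫⁻ x in Ioi (0 : ℝ), g x * e x) :
    ∀ᵐ x ∂volume.restrict (Ioc (0 : ℝ) 1), f x + translateSum f x = g x + translateSum g x := by
  have hunion : Ioi (0 : ℝ) = Ioc 0 1 ∪ Ioi 1 := (Ioc_union_Ioi_eq_Ioi zero_le_one).symm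
  have hdisj : Disjoint (Ioc (0 : ℝ) 1) (Ioi 1) := by
    rw [Set.disjoint_left]; intro x hx hx'; exact not_lt.2 hx.2 hx'
  have key : ∀ f : ℝ → ℝ≥0∞, Measurable f → ∀ e : UnitAddCircle → ℝ≥0∞, Measurable e →
      ∫⁻ x in Ioi (0 : ℝ), f x * e x = ∫⁻ x in Ioc (0 : ℝ) 1, (f x + translateSum f x) * e x := by
    intro f hf e he
    have hec : Measurable fun x : ℝ => e (x : UnitAddCircle) :=
      he.comp AddCircle.measurable_mk'
    have := setLIntegral_Ioi_mul_coe_unitAddCircle hf he 0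
    rw [zero_add] at this
    rw [hunion, lintegral_union measurableSet_Ioi hdisj, this]
    simp_rw [add_mul]
    exact (lintegral_add_left (hf.mul hec) _).symm
  have hmf := hf.add (measurable_translateSum hf)
  have hmg := hg.add (measurable_translateSum hg)
  refine ae_eq_of_forall_setLIntegral_eq_of_sigmaFinite hmf hmg fun S hS _ => ?_
  -- The indicator of `S`, transported to the circle through the fundamental domain `(0, 1]`, serves
  -- as test function.
  let e : UnitAddCircle → ℝ≥0∞ := fun z =>
    S.indicator 1 ((AddCircle.measurableEquivIoc 1 0 z : Ioc (0 : ℝ) (0 + 1)) : ℝ)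
  have he : Measurable e := (measurable_one.indicator hS).comp
    (measurable_subtype_coe.comp (AddCircle.measurableEquivIoc 1 0).measurable)
  have hex : ∀ x ∈ Ioc (0 : ℝ) 1, e x = S.indicator 1 x := by
    intro x hx
    have hx' : x ∈ Ioc (0 : ℝ) (0 + 1) := by simpa using hx
    have : AddCircle.measurableEquivIoc 1 0 (x : UnitAddCircle) = ⟨x, hx'⟩ :=
      (AddCircle.measurableEquivIoc 1 0).apply_symm_apply ⟨x, hx'⟩
    simp only [e, this]
  have hset : ∀ F : ℝ → ℝ≥0∞, ∫⁻ x in S, F x ∂volume.restrict (Ioc (0 : ℝ) 1) =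
      ∫⁻ x in Ioc (0 : ℝ) 1, F x * e x := by
    intro F
    rw [← lintegral_indicator hS]
    refine setLIntegral_congr_fun measurableSet_Ioc fun x hx => ?_
    simp only [hex x hx, indicator, Pi.one_apply]
    split_ifs <;> simp
  rw [hset, hset]
  exact (key f hf e he).symm.trans ((h e he).trans (key g hg e he))

/-- Whichever density vanishes at `x`, the other one is bounded by the translate sum of the
vanishing one. This is where mutual singularity turns an equality of periodizations into a one-sided
inequality. -/
theorem add_le_translateSum_add {f g : ℝ → ℝ≥0∞} {x : ℝ} (h0 : f x = 0 ∨ g x = 0)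
    (h : f x + translateSum f x = g x + translateSum g x) :
    f x + g x ≤ translateSum (fun y => f y + g y) x := by
  have hadd : translateSum (fun y => f y + g y) x = translateSum f x + translateSum g x :=
    ENNReal.tsum_add
  rw [hadd]
  rcases h0 with h0 | h0
  · rw [h0, zero_add] at h ⊢
    exact le_add_right (h ▸ le_self_add)
  · rw [h0, zero_add] at h
    rw [h0, add_zero]
    exact le_add_left (h ▸ le_self_add)

theorem invDensity_add (γ : ℝ) (f g : ℝ → ℝ≥0∞) (u : ℝ) :
    invDensity γ (fun y => f y + g y) u = invDensity γ f u + invDensity γ g u := by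
  simp only [invDensity, mul_add]

/-- Mutually singular finite measures on the positive half-line, absolutely continuous with
respect to Lebesgue measure, vanish if they agree modulo `1` in both of the coordinates
`s` and `γ / s`, where `γ < 1`. -/
theorem eq_zero_of_integral_fourier_eq {γ : ℝ} (hγ : 0 < γ) (hγ1 : γ < 1) {a b : Measure ℝ}
    [IsFiniteMeasure a] [IsFiniteMeasure b] (ha : a ≪ volume.restrict (Ioi 0))
    (hb : b ≪ volume.restrict (Ioi 0)) (hab : a ⟂ₘ b)
    (h1 : ∀ m : ℤ, ∫ s : ℝ, fourier m (s : UnitAddCircle) ∂a =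
      ∫ s : ℝ, fourier m (s : UnitAddCircle) ∂b)
    (h2 : ∀ m : ℤ, ∫ s : ℝ, fourier m ((γ / s : ℝ) : UnitAddCircle) ∂a =
      ∫ s : ℝ, fourier m ((γ / s : ℝ) : UnitAddCircle) ∂b) :
    a = 0 ∧ b = 0 := by
  set ρ : Measure ℝ := volume.restrict (Ioi 0) with hρ
  obtain ⟨f, hf, rfl⟩ : ∃ f : ℝ → ℝ≥0∞, Measurable f ∧ ρ.withDensity f = a :=
    ⟨a.rnDeriv ρ, Measure.measurable_rnDeriv _ _, Measure.withDensity_rnDeriv_eq _ _ ha⟩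
  obtain ⟨g, hg, rfl⟩ : ∃ g : ℝ → ℝ≥0∞, Measurable g ∧ ρ.withDensity g = b :=
    ⟨b.rnDeriv ρ, Measure.measurable_rnDeriv _ _, Measure.withDensity_rnDeriv_eq _ _ hb⟩
  have hmk : Measurable fun s : ℝ => (s : UnitAddCircle) := AddCircle.measurable_mk'
  have hmk' : Measurable fun s : ℝ => ((γ / s : ℝ) : UnitAddCircle) :=
    hmk.comp (measurable_const.div measurable_id)
  have hmap : ∀ φ : ℝ → UnitAddCircle, Measurable φ →
      (∀ m : ℤ, ∫ s, fourier m (φ s) ∂ρ.withDensity f = ∫ s, fourier m (φ s) ∂ρ.withDensity g) →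
      ∀ e : UnitAddCircle → ℝ≥0∞, Measurable e →
        ∫⁻ s, f s * e (φ s) ∂ρ = ∫⁻ s, g s * e (φ s) ∂ρ := by
    intro φ hφ h e he
    have : (ρ.withDensity f).map φ = (ρ.withDensity g).map φ := by
      refine ext_of_integral_fourier_eq fun m => ?_
      rw [integral_map hφ.aemeasurable (fourier m).continuous.aestronglyMeasurable,
        integral_map hφ.aemeasurable (fourier m).continuous.aestronglyMeasurable, h m]
    have hec : Measurable fun s => e (φ s) := he.comp hφ
    have h' := congrArg (fun μ : Measure UnitAddCircle => ∫⁻ z, e z ∂μ) this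
    rw [lintegral_map he hφ, lintegral_map he hφ,
      lintegral_withDensity_eq_lintegral_mul _ hf hec,
      lintegral_withDensity_eq_lintegral_mul _ hg hec] at h'
    exact h'
  have hp1 := ae_eq_periodization hf hg (hmap _ hmk h1)
  have hp2 := ae_eq_periodization (measurable_invDensity γ hf) (measurable_invDensity γ hg) (by
    intro e he
    have key : ∀ f : ℝ → ℝ≥0∞, ∫⁻ x in Ioi (0 : ℝ), invDensity γ f x * e x =
        ∫⁻ s, f s * e ((γ / s : ℝ) : UnitAddCircle) ∂ρ := by
      intro f
      rw [hρ, ← setLIntegral_Ioi_zero_invDensity hγ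
        (fun s => f s * e ((γ / s : ℝ) : UnitAddCircle))]
      refine setLIntegral_congr_fun measurableSet_Ioi fun x _ => ?_
      simp only [invDensity, div_div_cancel₀ hγ.ne', mul_assoc]
    rw [key, key]
    exact hmap _ hmk' h2 e he)
  have hfg : Measurable fun x => f x * g x := hf.mul hg
  have hprod : ∫⁻ x in Ioi 0, f x * g x = 0 := by
    obtain ⟨S, hS, hS1, hS2⟩ := hab
    rw [withDensity_apply_eq_zero hf] at hS1
    rw [withDensity_apply_eq_zero hg] at hS2
    rw [lintegral_eq_zero_iff hfg]
    filter_upwards [measure_eq_zero_iff_ae_notMem.1 hS1, measure_eq_zero_iff_ae_notMem.1 hS2]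
      with x hx1 hx2
    by_cases hx : x ∈ S
    · have : f x = 0 := by by_contra h; exact hx1 ⟨h, hx⟩
      simp [this]
    · have : g x = 0 := by by_contra h; exact hx2 ⟨h, hx⟩
      simp [this]
  have hsub : Ioc (0 : ℝ) 1 ⊆ Ioi 0 := fun x hx => hx.1
  have hz1 : ∀ᵐ x ∂volume.restrict (Ioc (0 : ℝ) 1), f x = 0 ∨ g x = 0 := by
    rw [lintegral_eq_zero_iff hfg] at hprod
    filter_upwards [ae_restrict_of_ae_restrict_of_subset hsub hprod] with x hx
    simpa using hx
  have hz2 : ∀ᵐ x ∂volume.restrict (Ioc (0 : ℝ) 1),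
      invDensity γ f x = 0 ∨ invDensity γ g x = 0 := by
    rw [← setLIntegral_Ioi_zero_invDensity hγ,
      lintegral_eq_zero_iff (measurable_invDensity γ hfg)] at hprod
    filter_upwards [ae_restrict_of_ae_restrict_of_subset hsub hprod] with x hx
    simp only [invDensity, Pi.zero_apply, mul_eq_zero] at hx ⊢
    tauto
  set F : ℝ → ℝ≥0∞ := fun y => f y + g y with hF
  have hFm : Measurable F := hf.add hg
  have hFi : Measurable (invDensity γ F) := measurable_invDensity γ hFm
  have hFfin : ∫⁻ x in Ioi 0, F x ≠ ∞ := by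
    rw [hF, lintegral_add_left hf, ← hρ, ← setLIntegral_univ f, ← setLIntegral_univ g,
      ← withDensity_apply _ .univ, ← withDensity_apply _ .univ]
    finiteness
  -- Inversion is an involution, so adding the inverted density to `F` produces the required
  -- invariance.
  have hH : ∀ᵐ x ∂volume.restrict (Ioc (0 : ℝ) 1), F x + invDensity γ F x = 0 := by
    refine ae_eq_zero_of_le_translateSum hγ hγ1 (hFm.add hFi) ?_ ?_ ?_
    · rw [lintegral_add_left hFm]
      refine ENNReal.add_ne_top.2 ⟨?_, ?_⟩
      · exact ne_top_of_le_ne_top hFfin (lintegral_mono_set hsub)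
      · refine ne_top_of_le_ne_top ?_ (lintegral_mono_set hsub)
        rwa [setLIntegral_Ioi_zero_invDensity hγ]
    · intro u hu
      rw [invDensity_add, invDensity_invDensity hγ F hu, add_comm]
    · filter_upwards [hz1, hz2, hp1, hp2] with x hx1 hx2 hx3 hx4
      have hadd : translateSum (fun y => F y + invDensity γ F y) x =
          translateSum F x + translateSum (invDensity γ F) x := ENNReal.tsum_add
      rw [hadd]
      have hi : invDensity γ F = fun y => invDensity γ f y + invDensity γ g y :=
        funext (invDensity_add γ f g)
      refine add_le_add (add_le_translateSum_add hx1 hx3) ?_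
      rw [hi]
      exact add_le_translateSum_add hx2 hx4
  have hF0 : ∫⁻ x in Ioc 0 1, F x = 0 := by
    rw [lintegral_eq_zero_iff hFm]
    filter_upwards [hH] with x hx using (add_eq_zero.1 hx).1
  have hFi0 : ∫⁻ x in Ioc 0 1, invDensity γ F x = 0 := by
    rw [lintegral_eq_zero_iff hFi]
    filter_upwards [hH] with x hx using (add_eq_zero.1 hx).2
  -- The mass of `F` beyond 1 is the mass of its inversion on `(0, γ)`, which lies inside `(0, 1]`.
  have hF1 : ∫⁻ x in Ioi 1, F x = 0 := by
    have : ∫⁻ x in Ioi 1, F x = ∫⁻ x in Ioo 0 γ, invDensity γ F x := by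
      rw [← setLIntegral_Ioi_one_invDensity hγ]
      exact setLIntegral_congr_fun measurableSet_Ioi fun y hy =>
        (invDensity_invDensity hγ F (zero_lt_one.trans hy)).symm
    rw [this]
    have hle : Ioo 0 γ ⊆ Ioc 0 1 := fun u hu => ⟨hu.1, hu.2.le.trans hγ1.le⟩
    exact le_antisymm ((lintegral_mono_set hle).trans hFi0.le) zero_le
  have hall : F =ᵐ[ρ] 0 := by
    rw [← lintegral_eq_zero_iff hFm, hρ, ← Ioc_union_Ioi_eq_Ioi zero_le_one]
    exact le_antisymm ((lintegral_union_le _ _ _).trans (by rw [hF0, hF1, add_zero])) zero_le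
  constructor
  · rw [withDensity_eq_zero_iff hf.aemeasurable]
    filter_upwards [hall] with x hx using (add_eq_zero.1 hx).1
  · rw [withDensity_eq_zero_iff hg.aemeasurable]
    filter_upwards [hall] with x hx using (add_eq_zero.1 hx).2

/-! ### The transfer operator for `γ ≥ 1` -/

/-- The density on `(1, ∞)` which cancels the density `F` on `(0, 1]` modulo `1` in the coordinate
`γ / x`, restricted to the image of the fundamental domain `(γ - 1, γ]`. -/
noncomputable def cancellingDensity (γ : ℝ) (F : ℝ → ℝ≥0∞) : ℝ → ℝ≥0∞ :=
  {y : ℝ | (γ - 1) * y < γ}.indicator (invDensity γ (translateSum (invDensity γ F)))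

/-- The transfer operator of the Gauss-type map attached to `γ ≥ 1`. -/
noncomputable def transferOp (γ : ℝ) (F : ℝ → ℝ≥0∞) : ℝ → ℝ≥0∞ :=
  translateSum (cancellingDensity γ F)

theorem measurableSet_cut (γ : ℝ) : MeasurableSet {y : ℝ | (γ - 1) * y < γ} :=
  measurableSet_lt (by fun_prop) measurable_const

theorem measurable_cancellingDensity (γ : ℝ) {F : ℝ → ℝ≥0∞} (hF : Measurable F) :
    Measurable (cancellingDensity γ F) :=
  (measurable_invDensity γ (measurable_translateSum (measurable_invDensity γ hF))).indicator
    (measurableSet_cut γ)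

theorem measurable_transferOp (γ : ℝ) {F : ℝ → ℝ≥0∞} (hF : Measurable F) :
    Measurable (transferOp γ F) :=
  measurable_translateSum (measurable_cancellingDensity γ hF)

/-- The summands are indexed by the maps `y ↦ γy / (γ + (j + 1)y)`, weighted by their derivatives.
This explicit form gives both monotonicity and the uniform bounds. -/
theorem invDensity_translateSum_invDensity {γ : ℝ} (hγ : 0 < γ) (F : ℝ → ℝ≥0∞) {y : ℝ}
    (hy : 0 < y) : invDensity γ (translateSum (invDensity γ F)) y =
      ∑' j : ℕ, ENNReal.ofReal (γ ^ 2 / (γ + ((j : ℝ) + 1) * y) ^ 2) *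
        F (γ * y / (γ + ((j : ℝ) + 1) * y)) := by
  simp only [invDensity, translateSum]
  rw [← ENNReal.tsum_mul_left]
  refine tsum_congr fun j => ?_
  rw [← mul_assoc, ← ENNReal.ofReal_mul (by positivity)]
  congr 2 <;> field_simp

/-- Inversion of the part of the half-line `(1, ∞)` lying over the interval `(γ - 1, γ]`. -/
theorem setLIntegral_indicator_invDensity {γ : ℝ} (hγ : 1 ≤ γ) (p : ℝ → ℝ≥0∞) :
    ∫⁻ y in Ioi 1, {y : ℝ | (γ - 1) * y < γ}.indicator (invDensity γ p) y =
      ∫⁻ u in Ioc (γ - 1) γ, p u := by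
  have hγ0 : 0 < γ := zero_lt_one.trans_le hγ
  calc _ = ∫⁻ y in Ioi 1, invDensity γ ((Ioi (γ - 1)).indicator p) y := by
        refine setLIntegral_congr_fun measurableSet_Ioi fun y hy => ?_
        have hy0 : 0 < y := zero_lt_one.trans hy
        simp only [indicator, mem_ofPred_eq, invDensity, mem_Ioi, lt_div_iff₀ hy0]
        split_ifs <;> simp
    _ = ∫⁻ u in Ioo 0 γ, (Ioi (γ - 1)).indicator p u := setLIntegral_Ioi_one_invDensity hγ0 _
    _ = ∫⁻ u in Ioo (γ - 1) γ, p u := by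
        rw [setLIntegral_indicator measurableSet_Ioi]
        congr 2
        ext u
        simp only [mem_inter_iff, mem_Ioi, mem_Ioo]
        constructor
        · rintro ⟨h1, -, h2⟩; exact ⟨h1, h2⟩
        · rintro ⟨h1, h2⟩; exact ⟨h1, by linarith, h2⟩
    _ = _ := setLIntegral_congr Ioo_ae_eq_Ioc

/-- The cancelling density has the same image modulo `1` as `F` in the coordinate `γ / x`. -/
theorem setLIntegral_cancellingDensity_mul {γ : ℝ} (hγ : 1 ≤ γ) {F : ℝ → ℝ≥0∞} (hF : Measurable F)
    {e : UnitAddCircle → ℝ≥0∞} (he : Measurable e) :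
    ∫⁻ y in Ioi 1, cancellingDensity γ F y * e ((γ / y : ℝ) : UnitAddCircle) =
      ∫⁻ x in Ioc 0 1, F x * e ((γ / x : ℝ) : UnitAddCircle) := by
  have hγ0 : 0 < γ := zero_lt_one.trans_le hγ
  calc _ = ∫⁻ y in Ioi 1, {y : ℝ | (γ - 1) * y < γ}.indicator
            (invDensity γ (fun u => translateSum (invDensity γ F) u * e u)) y := by
        congr 1 with y
        simp only [cancellingDensity, indicator, invDensity]
        split_ifs
        · rw [mul_assoc]
        · rw [zero_mul]
    _ = ∫⁻ u in Ioc (γ - 1) γ, translateSum (invDensity γ F) u * e u :=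
        setLIntegral_indicator_invDensity hγ _
    _ = ∫⁻ u in Ioi γ, invDensity γ F u * e u := by
        -- Unfolding with base point `γ - 1`: the period `(γ - 1, γ]` receives all the mass on `(γ,
        -- ∞)`, the inverted image of `(0, 1)`.
        have := setLIntegral_Ioi_mul_coe_unitAddCircle (measurable_invDensity γ hF) he (γ - 1)
        rw [sub_add_cancel] at this
        exact this.symm
    _ = ∫⁻ u in Ioi γ, invDensity γ (fun x => F x * e ((γ / x : ℝ) : UnitAddCircle)) u := by
        congr 1 with u
        simp only [invDensity, div_div_cancel₀ hγ0.ne', mul_assoc]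
    _ = _ := setLIntegral_Ioi_self_invDensity hγ0 _

theorem setLIntegral_cancellingDensity {γ : ℝ} (hγ : 1 ≤ γ) {F : ℝ → ℝ≥0∞} (hF : Measurable F) :
    ∫⁻ y in Ioi 1, cancellingDensity γ F y = ∫⁻ x in Ioc 0 1, F x := by
  simpa using setLIntegral_cancellingDensity_mul hγ hF (e := fun _ => 1) measurable_const

theorem setLIntegral_transferOp {γ : ℝ} (hγ : 1 ≤ γ) {F : ℝ → ℝ≥0∞} (hF : Measurable F) :
    ∫⁻ x in Ioc 0 1, transferOp γ F x = ∫⁻ x in Ioc 0 1, F x := by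
  have := setLIntegral_translateSum (measurable_cancellingDensity γ hF) 0
  rw [zero_add] at this
  rw [transferOp, this, setLIntegral_cancellingDensity hγ hF]

/-- The transfer operator preserves monotonicity: its inverse branches are increasing with
decreasing derivative. -/
theorem antitoneOn_transferOp {γ : ℝ} (hγ : 1 ≤ γ) {F : ℝ → ℝ≥0∞} (hF : AntitoneOn F (Ioi 0)) :
    AntitoneOn (transferOp γ F) (Ioi 0) := by
  have hγ0 : 0 < γ := zero_lt_one.trans_le hγ
  have hc : AntitoneOn (cancellingDensity γ F) (Ioi 0) := by
    intro y (hy : 0 < y) z (hz : 0 < z) hyz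
    simp only [cancellingDensity, indicator, mem_ofPred_eq]
    by_cases h : (γ - 1) * z < γ
    · have h' : (γ - 1) * y < γ :=
        (mul_le_mul_of_nonneg_left hyz (sub_nonneg.2 hγ)).trans_lt h
      rw [if_pos h, if_pos h', invDensity_translateSum_invDensity hγ0 F hy,
        invDensity_translateSum_invDensity hγ0 F hz]
      refine ENNReal.tsum_le_tsum fun j => ?_
      refine mul_le_mul' (ENNReal.ofReal_le_ofReal (by gcongr)) (hF ?_ ?_ ?_)
      · exact (by positivity : 0 < γ * y / (γ + ((j : ℝ) + 1) * y))
      · exact (by positivity : 0 < γ * z / (γ + ((j : ℝ) + 1) * z))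
      · rw [div_le_div_iff₀ (by positivity) (by positivity)]
        nlinarith [mul_le_mul_of_nonneg_left hyz (sq_nonneg γ)]
    · rw [if_neg h]
      exact zero_le
  intro x (hx : 0 < x) y (hy : 0 < y) hxy
  refine ENNReal.tsum_le_tsum fun k => hc ?_ ?_ (by linarith)
  · exact (by positivity : 0 < x + ((k : ℝ) + 1))
  · exact (by positivity : 0 < y + ((k : ℝ) + 1))

/-- A decreasing density carries at least `v * F v` on `(0, v]`, and the total mass is at most 1. -/
theorem le_ofReal_one_div_of_antitoneOn {F : ℝ → ℝ≥0∞} (hF : AntitoneOn F (Ioi 0))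
    (h1 : ∫⁻ x in Ioc 0 1, F x ≤ 1) {v : ℝ} (hv : 0 < v) (hv1 : v ≤ 1) :
    F v ≤ ENNReal.ofReal (1 / v) := by
  have h : F v * ENNReal.ofReal v ≤ 1 := by
    calc F v * ENNReal.ofReal v = ∫⁻ _ in Ioc 0 v, F v := by simp
      _ ≤ ∫⁻ x in Ioc 0 v, F x := setLIntegral_mono' measurableSet_Ioc fun x hx =>
          hF hx.1 hv hx.2
      _ ≤ ∫⁻ x in Ioc 0 1, F x := lintegral_mono_set (Ioc_subset_Ioc_right hv1)
      _ ≤ 1 := h1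
  rw [ENNReal.ofReal_div_of_pos hv, ENNReal.ofReal_one]
  rwa [ENNReal.le_div_iff_mul_le (Or.inl (by simpa using hv)) (Or.inl ENNReal.ofReal_ne_top)]

theorem tsum_ofReal_one_div_sq_ne_top :
    ∑' n : ℕ, ENNReal.ofReal (1 / ((n : ℝ) + 1) ^ 2) ≠ ∞ := by
  have hs : Summable fun n : ℕ => 1 / ((n : ℝ) + 1) ^ 2 := by
    have := (summable_nat_add_iff 1).2 (Real.summable_one_div_nat_pow.2 one_lt_two)
    simpa using this
  rw [← ENNReal.ofReal_tsum_of_nonneg (fun n => by positivity) hs]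
  exact ENNReal.ofReal_ne_top

/-- A uniform bound preserved by the transfer operator on decreasing densities. -/
theorem exists_bound_transferOp {γ : ℝ} (hγ : 1 ≤ γ) :
    ∃ C : ℝ≥0∞, 1 ≤ C ∧ C ≠ ∞ ∧ ∀ F : ℝ → ℝ≥0∞, AntitoneOn F (Ioi 0) →
      ∫⁻ x in Ioc 0 1, F x ≤ 1 → (∀ x, 0 < x → F x ≤ C) → ∀ x, 0 < x → transferOp γ F x ≤ C := by
  have hγ0 : 0 < γ := zero_lt_one.trans_le hγ
  set z : ℕ → ℝ≥0∞ := fun n => ENNReal.ofReal (1 / ((n : ℝ) + 1) ^ 2) with hz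
  have hZ : ∑' n, z n ≠ ∞ := tsum_ofReal_one_div_sq_ne_top
  -- The branches with `j ≥ m` together contribute at most half of any uniform bound for `F`.
  obtain ⟨m, hm⟩ : ∃ m : ℕ,
      ENNReal.ofReal (γ ^ 2) * (∑' n, z n) * ∑' j, z (j + m) ≤ 2⁻¹ := by
    have ht := ENNReal.Tendsto.const_mul (a := ENNReal.ofReal (γ ^ 2) * ∑' n, z n)
      (ENNReal.tendsto_sum_nat_add z hZ)
      (Or.inr (ENNReal.mul_ne_top ENNReal.ofReal_ne_top hZ))
    rw [mul_zero] at ht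
    exact (ht.eventually_le_const (by simp : (0 : ℝ≥0∞) < 2⁻¹)).exists
  set D : ℝ≥0∞ := m * ENNReal.ofReal γ * ∑' n, z n with hD
  have hDtop : D ≠ ∞ := by
    refine ENNReal.mul_ne_top (ENNReal.mul_ne_top ?_ ENNReal.ofReal_ne_top) hZ
    exact ENNReal.natCast_ne_top m
  -- `D` bounds the first `m` branches, so a constant with `D + C / 2 ≤ C` is needed; the extra 1
  -- makes the bound valid for the constant density 1.
  refine ⟨2 * D + 1, le_add_self, by finiteness, fun F hF h1 hC x hx => ?_⟩
  set C : ℝ≥0∞ := 2 * D + 1 with hCdef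
  have hterm : ∀ k : ℕ, cancellingDensity γ F (x + ((k : ℝ) + 1)) ≤
      m * ENNReal.ofReal γ * z k + ENNReal.ofReal (γ ^ 2) * z k * (∑' j, z (j + m)) * C := by
    intro k
    set y : ℝ := x + ((k : ℝ) + 1) with hy
    have hky : (k : ℝ) + 1 ≤ y := by linarith
    have hy0 : 0 < y := by positivity
    simp only [cancellingDensity, indicator, mem_ofPred_eq]
    split_ifs with hcut
    swap
    · exact zero_le
    rw [invDensity_translateSum_invDensity hγ0 F hy0,
      ← ENNReal.summable.sum_add_tsum_nat_add' (k := m)]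
    refine add_le_add ?_ ?_
    -- For small `j` the mass bound `F v ≤ 1 / v` is used, giving an estimate independent of `C`.
    · calc _ ≤ ∑ j ∈ Finset.range m, ENNReal.ofReal γ * z k := by
            refine Finset.sum_le_sum fun j _ => ?_
            set J : ℝ := (j : ℝ) + 1 with hJ
            have hJ1 : 1 ≤ J := by simp [hJ]
            have hJy : y ≤ J * y := by nlinarith
            have hv : F (γ * y / (γ + J * y)) ≤
                ENNReal.ofReal (1 / (γ * y / (γ + J * y))) := by
              refine le_ofReal_one_div_of_antitoneOn hF h1 (by positivity) ?_
              rw [div_le_one (by positivity)]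
              nlinarith
            refine (mul_le_mul_right hv _).trans ?_
            rw [← ENNReal.ofReal_mul (by positivity), hz, ← ENNReal.ofReal_mul hγ0.le]
            apply ENNReal.ofReal_le_ofReal
            have : γ ^ 2 / (γ + J * y) ^ 2 * (1 / (γ * y / (γ + J * y))) =
                γ * (1 / ((γ + J * y) * y)) := by field_simp
            rw [this]
            gcongr
            nlinarith
        _ = m * ENNReal.ofReal γ * z k := by simp [mul_assoc]
    -- For the tail, `F ≤ C` suffices since the weights are at most `γ² / ((k + 1)² (j + m + 1)²)`.
    · calc _ ≤ ∑' j : ℕ, ENNReal.ofReal (γ ^ 2) * z k * z (j + m) * C := by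
            refine ENNReal.tsum_le_tsum fun j => ?_
            set J : ℝ := ((j + m : ℕ) : ℝ) + 1 with hJ
            have hJ0 : 0 < J := by positivity
            refine mul_le_mul' ?_ (hC _ (by positivity))
            rw [hz, ← ENNReal.ofReal_mul (by positivity), ← ENNReal.ofReal_mul (by positivity)]
            apply ENNReal.ofReal_le_ofReal
            rw [mul_assoc, div_mul_div_comm, mul_one, mul_one_div, ← mul_pow]
            gcongr
            nlinarith
        _ = _ := by rw [ENNReal.tsum_mul_right, ENNReal.tsum_mul_left]
  calc transferOp γ F x ≤ ∑' k : ℕ, (m * ENNReal.ofReal γ * z k +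
          ENNReal.ofReal (γ ^ 2) * z k * (∑' j, z (j + m)) * C) := ENNReal.tsum_le_tsum hterm
    _ = D + ENNReal.ofReal (γ ^ 2) * (∑' n, z n) * (∑' j, z (j + m)) * C := by
        rw [ENNReal.tsum_add, ENNReal.tsum_mul_left, ENNReal.tsum_mul_right,
          ENNReal.tsum_mul_right, ENNReal.tsum_mul_left]
    _ ≤ D + 2⁻¹ * C := by gcongr
    _ ≤ C := by
        rw [hCdef, mul_add, ← mul_assoc, ENNReal.inv_mul_cancel two_ne_zero ENNReal.ofNat_ne_top,
          one_mul, mul_one, ← add_assoc, two_mul]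
        gcongr
        exact ENNReal.inv_le_one.2 one_le_two

/-! ### The invariant density -/

/-- Fatou's lemma for sums. -/
theorem tsum_liminf_le (a : ℕ → ℕ → ℝ≥0∞) :
    ∑' k, liminf (fun n => a n k) atTop ≤ liminf (fun n => ∑' k, a n k) atTop := by
  simp_rw [← lintegral_count]
  exact lintegral_liminf_le fun n => measurable_of_countable _

theorem translateSum_liminf_le (F : ℕ → ℝ → ℝ≥0∞) (x : ℝ) :
    translateSum (fun y => liminf (fun n => F n y) atTop) x ≤
      liminf (fun n => translateSum (F n) x) atTop :=
  tsum_liminf_le fun n k => F n (x + ((k : ℝ) + 1))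

theorem invDensity_liminf (γ : ℝ) (F : ℕ → ℝ → ℝ≥0∞) (x : ℝ) :
    invDensity γ (fun y => liminf (fun n => F n y) atTop) x =
      liminf (fun n => invDensity γ (F n) x) atTop :=
  (ENNReal.liminf_const_mul_of_ne_top ENNReal.ofReal_ne_top).symm

theorem translateSum_mono {F G : ℝ → ℝ≥0∞} (h : ∀ x, F x ≤ G x) (x : ℝ) :
    translateSum F x ≤ translateSum G x :=
  ENNReal.tsum_le_tsum fun _ => h _

theorem invDensity_mono (γ : ℝ) {F G : ℝ → ℝ≥0∞} (h : ∀ x, F x ≤ G x) (x : ℝ) :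
    invDensity γ F x ≤ invDensity γ G x :=
  mul_le_mul_right (h _) _

theorem transferOp_liminf_le (γ : ℝ) (F : ℕ → ℝ → ℝ≥0∞) (x : ℝ) :
    transferOp γ (fun y => liminf (fun n => F n y) atTop) x ≤
      liminf (fun n => transferOp γ (F n) x) atTop := by
  refine (translateSum_mono (fun y => ?_) x).trans (translateSum_liminf_le _ x)
  simp only [cancellingDensity, indicator]
  split_ifs
  · refine (invDensity_mono γ (fun u => ?_) y).trans (invDensity_liminf γ _ y).le
    refine (translateSum_mono (fun v => ?_) u).trans (translateSum_liminf_le _ u)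
    exact (invDensity_liminf γ F v).le
  · exact zero_le

/-- For `γ ≥ 1` the transfer operator has an invariant density. -/
theorem exists_invariant_density {γ : ℝ} (hγ : 1 ≤ γ) : ∃ h : ℝ → ℝ≥0∞, Measurable h ∧
    ∫⁻ x in Ioc 0 1, h x ≠ 0 ∧ ∫⁻ x in Ioc 0 1, h x ≠ ∞ ∧
      transferOp γ h =ᵐ[volume.restrict (Ioc 0 1)] h := by
  obtain ⟨C, hC1, hCtop, hC⟩ := exists_bound_transferOp hγ
  set F : ℕ → ℝ → ℝ≥0∞ := fun n => (transferOp γ)^[n] fun _ => 1 with hF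
  have hsucc : ∀ n, F (n + 1) = transferOp γ (F n) := fun n =>
    Function.iterate_succ_apply' _ _ _
  have hFm : ∀ n, Measurable (F n) := by
    intro n
    induction n with
    | zero => exact measurable_const
    | succ n ih => rw [hsucc]; exact measurable_transferOp γ ih
  have hFa : ∀ n, AntitoneOn (F n) (Ioi 0) := by
    intro n
    induction n with
    | zero => exact antitoneOn_const
    | succ n ih => rw [hsucc]; exact antitoneOn_transferOp hγ ih
  have hFi : ∀ n, ∫⁻ x in Ioc 0 1, F n x = 1 := by
    intro n
    induction n with
    | zero => simp [hF]
    | succ n ih => rw [hsucc, setLIntegral_transferOp hγ (hFm n), ih]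
  have hFC : ∀ n, ∀ x, 0 < x → F n x ≤ C := by
    intro n
    induction n with
    | zero => exact fun x _ => hC1
    | succ n ih => rw [hsucc]; exact hC _ (hFa n) (hFi n).le ih
  set c : ℝ := C.toReal with hc
  have hCc : C = ENNReal.ofReal c := (ENNReal.ofReal_toReal hCtop).symm
  have hc1 : 1 ≤ c := by
    rw [hc, ← ENNReal.toReal_one]
    exact ENNReal.toReal_mono hCtop hC1
  -- With density at most `c`, the interval `(0, δ]` carries at most half the mass. The other half
  -- lies where the decreasing density is at most its value at `δ`, so that value is at least `1 /
  -- 2`. This keeps the lower limit from vanishing.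
  set δ : ℝ := 1 / (2 * c) with hδ
  have hδ0 : 0 < δ := by positivity
  have hδ1 : δ ≤ 1 := by
    rw [hδ, div_le_one (by positivity)]; linarith
  have hlow : ∀ n, ∀ x ∈ Ioc 0 δ, 2⁻¹ ≤ F n x := by
    intro n x hx
    have h1 : (1 : ℝ≥0∞) ≤ 2⁻¹ + F n δ := by
      calc (1 : ℝ≥0∞) = ∫⁻ x in Ioc 0 δ ∪ Ioc δ 1, F n x := by
            rw [Ioc_union_Ioc_eq_Ioc hδ0.le hδ1, hFi]
        _ ≤ (∫⁻ x in Ioc 0 δ, F n x) + ∫⁻ x in Ioc δ 1, F n x := lintegral_union_le _ _ _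
        _ ≤ (∫⁻ _ in Ioc 0 δ, C) + ∫⁻ _ in Ioc δ 1, F n δ := by
            refine add_le_add (setLIntegral_mono' measurableSet_Ioc fun y hy => hFC n y hy.1)
              (setLIntegral_mono' measurableSet_Ioc fun y hy => ?_)
            exact hFa n hδ0 (hδ0.trans hy.1) hy.1.le
        _ ≤ 2⁻¹ + F n δ := by
            refine add_le_add ?_ ?_
            · rw [setLIntegral_const, Real.volume_Ioc, hCc, ← ENNReal.ofReal_mul (by positivity),
                show c * (δ - 0) = 2⁻¹ by rw [hδ]; field_simp; ring,
                ENNReal.ofReal_inv_of_pos two_pos, ENNReal.ofReal_ofNat]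
            · rw [setLIntegral_const, Real.volume_Ioc]
              refine mul_le_of_le_one_right' ?_
              rw [ENNReal.ofReal_le_one]; linarith
    have h2 : (2⁻¹ : ℝ≥0∞) ≤ F n δ := by
      rw [← ENNReal.inv_two_add_inv_two] at h1
      exact (ENNReal.add_le_add_iff_left (by simp)).1 h1
    exact h2.trans (hFa n hx.1 hδ0 hx.2)
  set h : ℝ → ℝ≥0∞ := fun x => liminf (fun n => F n x) atTop with hh
  have hhm : Measurable h := Measurable.liminf hFm
  have hle : ∀ x, transferOp γ h x ≤ h x := by
    intro x
    refine (transferOp_liminf_le γ F x).trans (le_of_eq ?_)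
    simp_rw [← hsucc]
    exact liminf_nat_add (fun n => F n x) 1
  have hint : ∫⁻ x in Ioc 0 1, h x ≤ 1 := by
    refine (lintegral_liminf_le hFm).trans (le_of_eq ?_)
    simp_rw [hFi]
    exact liminf_const 1
  have htop : ∫⁻ x in Ioc 0 1, h x ≠ ∞ := ne_top_of_le_ne_top ENNReal.one_ne_top hint
  refine ⟨h, hhm, ?_, htop, ?_⟩
  · have : ∫⁻ x in Ioc 0 δ, (2⁻¹ : ℝ≥0∞) ≤ ∫⁻ x in Ioc 0 1, h x := by
      refine (setLIntegral_mono' measurableSet_Ioc fun x hx => ?_).trans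
        (lintegral_mono_set (Ioc_subset_Ioc_right hδ1))
      exact le_liminf_of_le (h := Eventually.of_forall fun n => hlow n x hx)
    refine (lt_of_lt_of_le ?_ this).ne'
    rw [setLIntegral_const, Real.volume_Ioc, sub_zero]
    exact ENNReal.mul_pos (by simp) (by simpa using hδ0)
  -- Fatou only gives `transferOp γ h ≤ h`; preservation of the finite integral upgrades it to
  -- equality almost everywhere.
  · refine ae_eq_of_ae_le_of_lintegral_le (ae_of_all _ hle) ?_ hhm.aemeasurable ?_
    · rwa [setLIntegral_transferOp hγ hhm]
    · rw [setLIntegral_transferOp hγ hhm]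

/-- For `γ ≥ 1` there are distinct finite measures on the positive half-line, absolutely
continuous with respect to Lebesgue measure, which agree modulo `1` in both of the coordinates
`s` and `γ / s`. -/
theorem exists_integral_fourier_eq {γ : ℝ} (hγ : 1 ≤ γ) : ∃ a b : Measure ℝ,
    IsFiniteMeasure a ∧ IsFiniteMeasure b ∧ a ≪ volume.restrict (Ioi 0) ∧
    b ≪ volume.restrict (Ioi 0) ∧ a (Ioc 0 1) ≠ 0 ∧ b (Ioc 0 1) = 0 ∧
    (∀ m : ℤ, ∫ s : ℝ, fourier m (s : UnitAddCircle) ∂a =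
      ∫ s : ℝ, fourier m (s : UnitAddCircle) ∂b) ∧
    ∀ m : ℤ, ∫ s : ℝ, fourier m ((γ / s : ℝ) : UnitAddCircle) ∂a =
      ∫ s : ℝ, fourier m ((γ / s : ℝ) : UnitAddCircle) ∂b := by
  obtain ⟨h, hh, h0, htop, hinv⟩ := exists_invariant_density hγ
  set g := cancellingDensity γ h with hg
  have hgm : Measurable g := measurable_cancellingDensity γ hh
  have hgi : ∫⁻ y in Ioi 1, g y = ∫⁻ x in Ioc 0 1, h x := setLIntegral_cancellingDensity hγ hh
  set a : Measure ℝ := (volume.restrict (Ioc 0 1)).withDensity h with ha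
  set b : Measure ℝ := (volume.restrict (Ioi 1)).withDensity g with hb
  have hmk : Measurable fun s : ℝ => (s : UnitAddCircle) := AddCircle.measurable_mk'
  have hmk' : Measurable fun s : ℝ => ((γ / s : ℝ) : UnitAddCircle) :=
    hmk.comp (measurable_const.div measurable_id)
  have hmap : ∀ φ : ℝ → UnitAddCircle, Measurable φ →
      (∀ e : UnitAddCircle → ℝ≥0∞, Measurable e →
        ∫⁻ y in Ioi 1, g y * e (φ y) = ∫⁻ x in Ioc 0 1, h x * e (φ x)) →
      ∀ m : ℤ, ∫ s, fourier m (φ s) ∂a = ∫ s, fourier m (φ s) ∂b := by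
    intro φ hφ H m
    have : a.map φ = b.map φ := by
      refine Measure.ext_of_lintegral _ fun e he => ?_
      have hec : Measurable fun s => e (φ s) := he.comp hφ
      rw [lintegral_map he hφ, lintegral_map he hφ,
        lintegral_withDensity_eq_lintegral_mul _ hh hec,
        lintegral_withDensity_eq_lintegral_mul _ hgm hec]
      exact (H e he).symm
    rw [← integral_map (φ := φ) hφ.aemeasurable (fourier m).continuous.aestronglyMeasurable, this,
      integral_map hφ.aemeasurable (fourier m).continuous.aestronglyMeasurable]
  refine ⟨a, b, isFiniteMeasure_withDensity htop, isFiniteMeasure_withDensity (hgi ▸ htop),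
    (withDensity_absolutelyContinuous _ _).trans
      (Measure.absolutelyContinuous_of_le (Measure.restrict_mono (fun x hx => hx.1) le_rfl)),
    (withDensity_absolutelyContinuous _ _).trans
      (Measure.absolutelyContinuous_of_le
        (Measure.restrict_mono (Ioi_subset_Ioi zero_le_one) le_rfl)), ?_, ?_,
    hmap _ hmk fun e he => ?_, hmap _ hmk' fun e he => ?_⟩
  · rw [ha, withDensity_apply _ measurableSet_Ioc, Measure.restrict_restrict measurableSet_Ioc,
      inter_self]
    exact h0
  · rw [hb, withDensity_apply _ measurableSet_Ioc, Measure.restrict_restrict measurableSet_Ioc,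
      Ioc_inter_Ioi, max_eq_right zero_le_one]
    simp
  · have := setLIntegral_Ioi_mul_coe_unitAddCircle hgm he 0
    rw [zero_add] at this
    -- In the coordinate `s`, agreement modulo 1 is precisely the fixed-point equation for `h`.
    rw [this]
    refine lintegral_congr_ae ?_
    filter_upwards [hinv] with x hx
    rw [← hx, hg, transferOp]
  · exact setLIntegral_cancellingDensity_mul hγ hh he

/-! ### Complex measures as combinations of finite positive measures -/

section ComplexMeasure

variable {X : Type*} [MeasurableSpace X]

/-- The complex measure `c • a` attached to a finite measure `a` and a complex number `c`. -/
noncomputable def smulMeasure (a : Measure X) [IsFiniteMeasure a] (c : ℂ) : ComplexMeasure X :=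
  a.toSignedMeasure.mapRange ((ContinuousLinearMap.toSpanSingleton ℝ c).toLinearMap.toAddMonoidHom)
    (ContinuousLinearMap.toSpanSingleton ℝ c).continuous

theorem smulMeasure_apply (a : Measure X) [IsFiniteMeasure a] (c : ℂ) {s : Set X}
    (hs : MeasurableSet s) : smulMeasure a c s = (a.real s : ℂ) * c := by
  simp [smulMeasure, VectorMeasure.mapRange_apply, Measure.toSignedMeasure_apply_measurable hs]

theorem variation_smulMeasure_le (a : Measure X) [IsFiniteMeasure a] (c : ℂ) :
    (smulMeasure a c).variation ≤ ‖c‖ₑ • a := by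
  refine VectorMeasure.variation_le_of_forall_enorm_le fun s hs => ?_
  rw [smulMeasure_apply a c hs, enorm_mul, mul_comm, Measure.smul_apply, smul_eq_mul]
  gcongr
  rw [← ofReal_norm, Complex.norm_real, Real.norm_of_nonneg measureReal_nonneg,
    ofReal_measureReal]

theorem integrable_smulMeasure {a : Measure X} [IsFiniteMeasure a] (c : ℂ) {f : X → ℂ}
    (hf : Integrable f a) : (smulMeasure a c).Integrable f :=
  (hf.smul_measure enorm_ne_top).mono_measure (variation_smulMeasure_le a c)

theorem integral_smulMeasure {a : Measure X} [IsFiniteMeasure a] (c : ℂ) {f : X → ℂ}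
    (hf : Integrable f a) :
    ∫ᵛ x, f x ∂[ContinuousLinearMap.mul ℝ ℂ; smulMeasure a c] = (∫ x, f x ∂a) * c := by
  set T := (smulMeasure a c).transpose (ContinuousLinearMap.mul ℝ ℂ) with hTdef
  have hTs : ∀ s, MeasurableSet s → ∀ z, T s z = z * ((a.real s : ℂ) * c) := by
    intro s hs z
    rw [hTdef, transpose_eq_cbmApplyMeasure, cbmApplyMeasure_apply, smulMeasure_apply a c hs]
    rfl
  have hT : DominatedFinMeasAdditive a T ‖c‖ := by
    refine ⟨fun s t hs ht _ _ hdisj => ?_, fun s hs _ => ?_⟩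
    · exact VectorMeasure.of_union hdisj hs ht
    refine ContinuousLinearMap.opNorm_le_bound _ (by positivity) fun z => ?_
    rw [hTs s hs, norm_mul, norm_mul, Complex.norm_real, Real.norm_of_nonneg measureReal_nonneg]
    exact le_of_eq (by ring)
  have h1 : ∫ᵛ x, f x ∂[ContinuousLinearMap.mul ℝ ℂ; smulMeasure a c] = setToFun a T hT f := by
    rw [VectorMeasure.integral_eq_setToFun]
    exact (setToFun_congr_measure_of_integrable _ enorm_ne_top (variation_smulMeasure_le a c)
      hT _ f hf).symm
  rw [h1]
  -- Both sides are additive and continuous in `f` for the `L¹` norm, so indicators suffice.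
  refine Integrable.induction (P := fun f => setToFun a T hT f = (∫ x, f x ∂a) * c)
    ?_ ?_ ?_ ?_ hf
  · intro z s hs hfin
    rw [setToFun_indicator_const hT hs hfin.ne, hTs s hs, integral_indicator_const z hs,
      Complex.real_smul]
    ring
  · intro f g _ hf hg h1 h2
    rw [setToFun_add hT hf hg, h1, h2, integral_add' hf hg, add_mul]
  · exact isClosed_eq (continuous_setToFun hT) (continuous_integral.mul continuous_const)
  · intro f g hfg _ h
    rw [← setToFun_congr_ae hT hfg, h, integral_congr_ae hfg]

/-- The integral with respect to a complex measure in terms of finite measures whose differences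
are its real and imaginary parts. -/
theorem integral_complexMeasure_eq {μ : ComplexMeasure X} {a b c d : Measure X}
    [IsFiniteMeasure a] [IsFiniteMeasure b] [IsFiniteMeasure c] [IsFiniteMeasure d]
    (hre : ∀ s, MeasurableSet s → (μ s).re = a.real s - b.real s)
    (him : ∀ s, MeasurableSet s → (μ s).im = c.real s - d.real s)
    {f : X → ℂ} (hf : Measurable f) {R : ℝ} (hR : ∀ x, ‖f x‖ ≤ R) :
    ∫ᵛ x, f x ∂[ContinuousLinearMap.mul ℝ ℂ; μ] =
      ((∫ x, f x ∂a) - ∫ x, f x ∂b) + Complex.I * ((∫ x, f x ∂c) - ∫ x, f x ∂d) := by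
  have hi : ∀ (a : Measure X) [IsFiniteMeasure a], Integrable f a := fun a _ =>
    Integrable.of_bound hf.aestronglyMeasurable R (ae_of_all _ hR)
  have hμ : μ = (smulMeasure a 1 - smulMeasure b 1) +
      (smulMeasure c Complex.I - smulMeasure d Complex.I) := by
    ext s hs
    rw [add_apply, sub_apply, sub_apply,
      smulMeasure_apply _ _ hs, smulMeasure_apply _ _ hs, smulMeasure_apply _ _ hs,
      smulMeasure_apply _ _ hs]
    apply Complex.ext
    · simp [hre s hs]
    · simp [him s hs]
  have ia := integrable_smulMeasure 1 (hi a)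
  have ib := integrable_smulMeasure 1 (hi b)
  have ic := integrable_smulMeasure Complex.I (hi c)
  have id := integrable_smulMeasure Complex.I (hi d)
  rw [hμ, VectorMeasure.integral_add_vectorMeasure (ia.sub_vectorMeasure ib)
      (ic.sub_vectorMeasure id), VectorMeasure.integral_sub_vectorMeasure ia ib,
    VectorMeasure.integral_sub_vectorMeasure ic id, integral_smulMeasure _ (hi a),
    integral_smulMeasure _ (hi b), integral_smulMeasure _ (hi c), integral_smulMeasure _ (hi d)]
  ring

theorem isFiniteMeasure_variation (μ : ComplexMeasure X) : IsFiniteMeasure μ.variation := by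
  have hfin : ∀ s : SignedMeasure X, IsFiniteMeasure s.totalVariation := fun s => by
    unfold SignedMeasure.totalVariation; infer_instance
  have := hfin (ComplexMeasure.re μ)
  have := hfin (ComplexMeasure.im μ)
  refine isFiniteMeasure_of_le ((ComplexMeasure.re μ).totalVariation +
    (ComplexMeasure.im μ).totalVariation) ?_
  refine VectorMeasure.variation_le_of_forall_enorm_le fun s _ => ?_
  rw [Measure.add_apply]
  refine le_trans ?_ (add_le_add (SignedMeasure.enorm_le_totalVariation _ s)
    (SignedMeasure.enorm_le_totalVariation _ s))
  have hre : ComplexMeasure.re μ s = (μ s).re := rfl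
  have him : ComplexMeasure.im μ s = (μ s).im := rfl
  calc ‖μ s‖ₑ = ‖((μ s).re : ℂ) + (μ s).im * Complex.I‖ₑ := by rw [Complex.re_add_im]
    _ ≤ ‖((μ s).re : ℂ)‖ₑ + ‖((μ s).im : ℂ) * Complex.I‖ₑ := enorm_add_le _ _
    _ = _ := by
      rw [enorm_mul, hre, him]
      simp [← ofReal_norm]

theorem totalVariation_absolutelyContinuous {s : SignedMeasure X} {ρ : Measure X}
    (h : ∀ E, MeasurableSet E → ρ E = 0 → s E = 0) : s.totalVariation ≪ ρ := by
  refine Measure.AbsolutelyContinuous.mk fun E hE hE0 => ?_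
  rw [SignedMeasure.totalVariation_eq_variation, VectorMeasure.variation_apply_eq_zero hE]
  intro t htE ht
  exact h t ht (measure_mono_null htE hE0)

end ComplexMeasure

/-! ### Linearity of the vanishing condition and reduction to one branch -/

theorem norm_fourierKernel (x ξ : Plane) :
    ‖Complex.exp (Complex.I * (Real.pi : ℂ) * ((inner ℝ x ξ : ℝ) : ℂ))‖ = 1 := by
  rw [show Complex.I * (Real.pi : ℂ) * ((inner ℝ x ξ : ℝ) : ℂ) =
    ((Real.pi * inner ℝ x ξ : ℝ) : ℂ) * Complex.I by push_cast; ring]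
  exact Complex.norm_exp_ofReal_mul_I _

theorem measurable_fourierKernel (ξ : Plane) : Measurable fun x : Plane =>
    Complex.exp (Complex.I * (Real.pi : ℂ) * ((inner ℝ x ξ : ℝ) : ℂ)) := by
  fun_prop

theorem measureFourier_sub (μ ν : ComplexMeasure Plane) (ξ : Plane) :
    measureFourier (μ - ν) ξ = measureFourier μ ξ - measureFourier ν ξ := by
  have hi : ∀ μ : ComplexMeasure Plane, μ.Integrable fun x : Plane =>
      Complex.exp (Complex.I * (Real.pi : ℂ) * ((inner ℝ x ξ : ℝ) : ℂ)) := fun μ => by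
    have := isFiniteMeasure_variation μ
    exact Integrable.of_bound (measurable_fourierKernel ξ).aestronglyMeasurable 1
      (ae_of_all _ fun x => (norm_fourierKernel x ξ).le)
  exact VectorMeasure.integral_sub_vectorMeasure (hi μ) (hi ν)

theorem sub_mem_ACVanishing {Γ Λ : Set Plane} {μ ν : ComplexMeasure Plane}
    (hμ : μ ∈ ACVanishing Γ Λ) (hν : ν ∈ ACVanishing Γ Λ) : μ - ν ∈ ACVanishing Γ Λ := by
  refine ⟨⟨fun s hs hd => ?_, fun s hs h0 => ?_⟩, fun ξ hξ => ?_⟩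
  · rw [sub_apply, hμ.1.1 s hs hd, hν.1.1 s hs hd, sub_zero]
  · rw [sub_apply, hμ.1.2 s hs h0, hν.1.2 s hs h0, sub_zero]
  · rw [measureFourier_sub, hμ.2 ξ hξ, hν.2 ξ hξ, sub_zero]

theorem zero_mem_ACVanishing (Γ Λ : Set Plane) : (0 : ComplexMeasure Plane) ∈ ACVanishing Γ Λ :=
  ⟨⟨fun _ _ _ => rfl, fun _ _ _ => rfl⟩,
    fun _ _ => VectorMeasure.integral_zero_vectorMeasure⟩

/-- The measures on `B ∪ B'` are determined by their restrictions to `B'` if and only if no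
nonzero one is carried by `B`. -/
theorem determined_iff {Γ Λ B B' : Set Plane} (hB' : MeasurableSet B')
    (hΓ : Γ ⊆ B ∪ B') (hd : Disjoint B B') :
    (∀ μ ∈ ACVanishing Γ Λ, ∀ ν ∈ ACVanishing Γ Λ, μ.restrict B' = ν.restrict B' → μ = ν) ↔
      ∀ μ ∈ ACVanishing Γ Λ, (∀ s, MeasurableSet s → Disjoint s B → μ s = 0) → μ = 0 := by
  constructor
  · intro h μ hμ hs
    refine h μ hμ 0 (zero_mem_ACVanishing Γ Λ) ?_
    ext s hsm
    rw [VectorMeasure.restrict_apply _ hB' hsm, VectorMeasure.restrict_apply _ hB' hsm,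
      hs _ (hsm.inter hB') (hd.symm.mono_left inter_subset_right)]
    rfl
  · intro h μ hμ ν hν heq
    have hsub := sub_mem_ACVanishing hμ hν
    refine sub_eq_zero.1 (h _ hsub fun s hs hsB => ?_)
    have h1 : (μ - ν) (s ∩ B') = 0 := by
      rw [sub_apply, ← VectorMeasure.restrict_apply μ hB' hs,
        ← VectorMeasure.restrict_apply ν hB' hs, heq, sub_self]
    have h2 : (μ - ν) (s \ B') = 0 := by
      refine hsub.1.1 _ (hs.diff hB') (Set.disjoint_left.2 fun x hx hxΓ => ?_)
      rcases hΓ hxΓ with hxB | hxB'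
      · exact Set.disjoint_left.1 hsB hx.1 hxB
      · exact hx.2 hxB'
    rw [← inter_union_sdiff s B', VectorMeasure.of_union
      (disjoint_sdiff_right.mono_left inter_subset_right) (hs.inter hB') (hs.diff hB'), h1, h2,
      add_zero]

/-! ### Parametrization of a branch and null sets for arc length -/

/-- The branch of the hyperbola on which `ε x₁ > 0`. -/
def branch (ε : ℤ) (M : ℝ) : Set Plane :=
  hyperbola M ∩ {x | 0 < (ε : ℝ) * x 0}

/-- The parametrization of a branch adapted to the lattice-cross. -/
noncomputable def branchParam (ε : ℤ) (α β γ s : ℝ) : Plane :=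
  !₂[ε * (2 * s / α), ε * (2 * γ / (β * s))]

/-- The inverse of `branchParam`. -/
noncomputable def branchCoord (ε : ℤ) (α : ℝ) (x : Plane) : ℝ := ε * (α * x 0 / 2)

theorem measurable_branchParam (ε : ℤ) (α β γ : ℝ) : Measurable (branchParam ε α β γ) := by
  unfold branchParam
  refine (PiLp.continuous_toLp 2 _).measurable.comp (measurable_pi_iff.2 fun i => ?_)
  fin_cases i
  · simp; fun_prop
  · simp; fun_prop

theorem measurable_branchCoord (ε : ℤ) (α : ℝ) : Measurable (branchCoord ε α) := by
  unfold branchCoord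
  fun_prop

theorem measurableSet_branch (ε : ℤ) (M : ℝ) : MeasurableSet (branch ε M) :=
  (measurableSet_hyperbola M).inter (measurableSet_lt measurable_const (by fun_prop))

theorem intCast_mul_self {ε : ℤ} (hε : ε * ε = 1) : (ε : ℝ) * ε = 1 := by exact_mod_cast hε

theorem branchCoord_branchParam {ε : ℤ} (hε : ε * ε = 1) {α : ℝ} (hα : 0 < α) (β γ s : ℝ) :
    branchCoord ε α (branchParam ε α β γ s) = s := by
  have := intCast_mul_self hε
  simp only [branchCoord, branchParam, PiLp.toLp_apply, Matrix.cons_val_zero]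
  field_simp
  linear_combination s * this

theorem branchCoord_pos {ε : ℤ} {α M : ℝ} (hα : 0 < α) {x : Plane} (hx : x ∈ branch ε M) :
    0 < branchCoord ε α x := by
  have h : 0 < (ε : ℝ) * x 0 := hx.2
  have : branchCoord ε α x = α / 2 * (ε * x 0) := by unfold branchCoord; ring
  rw [this]
  positivity

theorem branchParam_branchCoord {ε : ℤ} (hε : ε * ε = 1) {α β M γ : ℝ} (hα : 0 < α) (hβ : 0 < β)
    (hγ : γ = α * β * M ^ 2 / (16 * Real.pi ^ 2)) {x : Plane} (hx : x ∈ branch ε M) :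
    branchParam ε α β γ (branchCoord ε α x) = x := by
  have h1 := intCast_mul_self hε
  have hx0 : x 0 ≠ 0 := by
    intro h
    have := hx.2
    simp [h] at this
  have hε0 : (ε : ℝ) ≠ 0 := left_ne_zero_of_mul_eq_one h1
  have hxy : x 0 * x 1 = M ^ 2 / (4 * Real.pi ^ 2) := hx.1
  ext i
  fin_cases i
  · simp only [branchCoord, branchParam, PiLp.toLp_apply, Fin.zero_eta, Matrix.cons_val_zero]
    field_simp
    linear_combination h1
  · simp only [branchCoord, branchParam, PiLp.toLp_apply, Fin.mk_one, Matrix.cons_val_one,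
      Matrix.cons_val_zero]
    have : x 1 = M ^ 2 / (4 * Real.pi ^ 2) / x 0 := by
      rw [eq_div_iff hx0, mul_comm]; exact hxy
    rw [this, hγ]
    have := Real.pi_pos
    field_simp
    ring

theorem branchParam_mem {ε : ℤ} (hε : ε * ε = 1) {α β M γ : ℝ} (hα : 0 < α) (hβ : 0 < β)
    (hγ : γ = α * β * M ^ 2 / (16 * Real.pi ^ 2)) {s : ℝ} (hs : 0 < s) :
    branchParam ε α β γ s ∈ branch ε M := by
  have h1 := intCast_mul_self hε
  have := Real.pi_pos
  refine ⟨?_, ?_⟩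
  · change (ε : ℝ) * (2 * s / α) * (ε * (2 * γ / (β * s))) = _
    rw [hγ]
    field_simp
    linear_combination 16 * M ^ 2 * h1
  · change 0 < (ε : ℝ) * (ε * (2 * s / α))
    rw [← mul_assoc, h1]
    positivity

theorem exp_inner_branchParam_fst (ε : ℤ) {α : ℝ} (hα : 0 < α) (β γ s : ℝ) (m : ℤ) :
    Complex.exp (Complex.I * (Real.pi : ℂ) *
      ((inner ℝ (branchParam ε α β γ s) !₂[α * m, 0] : ℝ) : ℂ)) =
      fourier (ε * m) (s : UnitAddCircle) := by
  rw [fourier_coe_apply]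
  congr 1
  have : (α : ℂ) ≠ 0 := by exact_mod_cast hα.ne'
  simp [branchParam, PiLp.inner_apply, Fin.sum_univ_two]
  field_simp

theorem exp_inner_branchParam_snd (ε : ℤ) (α : ℝ) {β : ℝ} (hβ : 0 < β) (γ s : ℝ) (n : ℤ) :
    Complex.exp (Complex.I * (Real.pi : ℂ) *
      ((inner ℝ (branchParam ε α β γ s) !₂[0, β * n] : ℝ) : ℂ)) =
      fourier (ε * n) ((γ / s : ℝ) : UnitAddCircle) := by
  rw [fourier_coe_apply]
  congr 1
  have : (β : ℂ) ≠ 0 := by exact_mod_cast hβ.ne'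
  simp [branchParam, PiLp.inner_apply, Fin.sum_univ_two]
  field_simp

theorem fst_mem_latticeCross (α β : ℝ) (m : ℤ) : (!₂[α * m, 0] : Plane) ∈ latticeCross α β :=
  Or.inl ⟨⟨m, rfl⟩, rfl⟩

theorem snd_mem_latticeCross (α β : ℝ) (n : ℤ) : (!₂[0, β * n] : Plane) ∈ latticeCross α β :=
  Or.inr ⟨rfl, ⟨n, rfl⟩⟩

theorem eq_of_mem_latticeCross {α β : ℝ} {ξ : Plane} (hξ : ξ ∈ latticeCross α β) :
    (∃ m : ℤ, ξ = !₂[α * m, 0]) ∨ ∃ n : ℤ, ξ = !₂[0, β * n] := by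
  rcases hξ with ⟨⟨m, hm⟩, h⟩ | ⟨h, ⟨n, hn⟩⟩
  · refine Or.inl ⟨m, ?_⟩
    ext i
    fin_cases i
    · exact hm
    · exact h
  · refine Or.inr ⟨n, ?_⟩
    ext i
    fin_cases i
    · exact h
    · exact hn

theorem lipschitzWith_branchCoord (ε : ℤ) (α : ℝ) :
    ∃ K, LipschitzWith K (branchCoord ε α) := by
  have h : branchCoord ε α = ⇑(((ε : ℝ) * α / 2) • (EuclideanSpace.proj 0 : Plane →L[ℝ] ℝ)) := by
    ext x
    simp [branchCoord]
    ring
  rw [h]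
  exact ⟨_, ContinuousLinearMap.lipschitz _⟩

/-- Sets which are null for arc length have null preimages in the parameter. -/
theorem volume_preimage_branchParam {ε : ℤ} (hε : ε * ε = 1) {α β M γ : ℝ} (hα : 0 < α)
    (hβ : 0 < β) (hγ : γ = α * β * M ^ 2 / (16 * Real.pi ^ 2)) {E : Set Plane}
    (hE : MeasurableSet E) (h0 : arcLength (hyperbola M) E = 0) :
    volume.restrict (Ioi 0) (branchParam ε α β γ ⁻¹' E) = 0 := by
  rw [arcLength, Measure.restrict_apply hE] at h0
  rw [Measure.restrict_apply (measurable_branchParam ε α β γ hE)]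
  obtain ⟨K, hK⟩ := lipschitzWith_branchCoord ε α
  have hsub : branchParam ε α β γ ⁻¹' E ∩ Ioi 0 ⊆ branchCoord ε α '' (E ∩ hyperbola M) :=
    fun s hs => ⟨branchParam ε α β γ s, ⟨hs.1, (branchParam_mem hε hα hβ hγ hs.2).1⟩,
      branchCoord_branchParam hε hα β γ s⟩
  refine measure_mono_null hsub ?_
  have := hK.hausdorffMeasure_image_le zero_le_one (E ∩ hyperbola M)
  rw [h0, mul_zero, hausdorffMeasure_real] at this
  exact le_antisymm this zero_le

/-- The second coordinate blows up at 0, so the Lipschitz bound holds only away from 0; a countable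
exhaustion then suffices for null sets. -/
theorem lipschitzOnWith_branchParam {ε : ℤ} (hε : ε * ε = 1) (α β γ : ℝ) {δ : ℝ} (hδ : 0 < δ) :
    ∃ K, LipschitzOnWith K (branchParam ε α β γ) (Ici δ) := by
  refine ⟨Real.toNNReal (|2 / α| + |2 * γ / β| / δ ^ 2), LipschitzOnWith.of_dist_le_mul ?_⟩
  intro s hs t ht
  have hs0 : 0 < s := hδ.trans_le hs
  have ht0 : 0 < t := hδ.trans_le ht
  have hε1 : |(ε : ℝ)| = 1 := by
    have := congrArg abs (intCast_mul_self hε)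
    rw [abs_mul, abs_one, ← sq] at this
    exact (pow_eq_one_iff_of_nonneg (abs_nonneg _) two_ne_zero).1 this
  rw [Real.coe_toNNReal _ (by positivity), EuclideanSpace.dist_eq, Fin.sum_univ_two]
  have h0 : dist (branchParam ε α β γ s 0) (branchParam ε α β γ t 0) = |2 / α| * |s - t| := by
    change |(ε : ℝ) * (2 * s / α) - ε * (2 * t / α)| = _
    rw [show (ε : ℝ) * (2 * s / α) - ε * (2 * t / α) = ε * (2 / α * (s - t)) by ring, abs_mul, hε1,
      one_mul, abs_mul]
  have h1 : dist (branchParam ε α β γ s 1) (branchParam ε α β γ t 1) ≤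
      |2 * γ / β| / δ ^ 2 * |s - t| := by
    change |(ε : ℝ) * (2 * γ / (β * s)) - ε * (2 * γ / (β * t))| ≤ _
    have : (ε : ℝ) * (2 * γ / (β * s)) - ε * (2 * γ / (β * t)) =
        ε * (2 * γ / β * ((t - s) / (s * t))) := by
      rw [show (t - s) / (s * t) = s⁻¹ - t⁻¹ by field_simp, div_mul_eq_div_mul_one_div,
        div_mul_eq_div_mul_one_div _ β t]
      ring
    rw [this, abs_mul, hε1, one_mul, abs_mul, abs_div (t - s), abs_of_pos (mul_pos hs0 ht0),
      abs_sub_comm t s, div_mul_eq_mul_div, mul_div_assoc |2 * γ / β|]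
    refine mul_le_mul_of_nonneg_left ?_ (abs_nonneg _)
    refine div_le_div_of_nonneg_left (abs_nonneg _) (by positivity) ?_
    rw [sq]
    exact mul_le_mul hs ht hδ.le hs0.le
  refine (Real.sqrt_le_iff.2 ⟨add_nonneg dist_nonneg dist_nonneg, ?_⟩ :
    _ ≤ dist (branchParam ε α β γ s 0) (branchParam ε α β γ t 0) +
      dist (branchParam ε α β γ s 1) (branchParam ε α β γ t 1)).trans ?_
  · nlinarith [mul_nonneg (dist_nonneg (x := branchParam ε α β γ s 0)
      (y := branchParam ε α β γ t 0)) (dist_nonneg (x := branchParam ε α β γ s 1)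
      (y := branchParam ε α β γ t 1))]
  · rw [h0, Real.dist_eq, add_mul]
    exact add_le_add_right h1 _

/-- Null sets of the parameter correspond to sets which are null for arc length. -/
theorem arcLength_preimage_branchCoord {ε : ℤ} (hε : ε * ε = 1) {α β M γ : ℝ} (hα : 0 < α)
    (hβ : 0 < β) (hγ : γ = α * β * M ^ 2 / (16 * Real.pi ^ 2)) {N : Set ℝ}
    (hN : MeasurableSet N) (h0 : volume.restrict (Ioi 0) N = 0) :
    arcLength (hyperbola M) (branchCoord ε α ⁻¹' N ∩ branch ε M) = 0 := by
  rw [Measure.restrict_apply hN] at h0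
  rw [arcLength]
  refine measure_mono_null (t := ⋃ n : ℕ, branchParam ε α β γ '' (N ∩ Ici (1 / ((n : ℝ) + 1))))
    ?_ ?_
  · rintro x ⟨hxN, hx⟩
    have hpos := branchCoord_pos hα hx
    obtain ⟨n, hn⟩ := exists_nat_one_div_lt hpos
    exact mem_iUnion.2 ⟨n, branchCoord ε α x, ⟨hxN, hn.le⟩,
      branchParam_branchCoord hε hα hβ hγ hx⟩
  · refine nonpos_iff_eq_zero.1 ((Measure.restrict_apply_le _ _).trans (le_of_eq ?_))
    refine measure_iUnion_null fun n => ?_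
    have hδ : 0 < 1 / ((n : ℝ) + 1) := by positivity
    obtain ⟨K, hK⟩ := lipschitzOnWith_branchParam hε α β γ hδ
    have := (hK.mono (inter_subset_right (s := N))).hausdorffMeasure_image_le zero_le_one
    have hz : volume (N ∩ Ici (1 / ((n : ℝ) + 1))) = 0 :=
      measure_mono_null (inter_subset_inter_right N fun x hx => hδ.trans_le hx) h0
    rw [hausdorffMeasure_real, hz, mul_zero] at this
    exact le_antisymm this zero_le

/-! ### Uniqueness and existence on a branch -/

theorem conj_integral_fourier (a : Measure ℝ) (φ : ℝ → UnitAddCircle) (m : ℤ) :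
    (starRingEnd ℂ) (∫ s, fourier m (φ s) ∂a) = ∫ s, fourier (-m) (φ s) ∂a := by
  rw [← integral_conj]
  simp only [fourier_neg]

/-- Conjugating the relation at `-m` gives `u m - i v m = 0`. This separates the real and imaginary
parts of a complex measure, using the symmetry of the lattice-cross. -/
theorem eq_zero_of_add_I_mul_eq_zero {u v : ℤ → ℂ} (hu : ∀ m, (starRingEnd ℂ) (u m) = u (-m))
    (hv : ∀ m, (starRingEnd ℂ) (v m) = v (-m)) (h : ∀ m, u m + Complex.I * v m = 0) (m : ℤ) :
    u m = 0 ∧ v m = 0 := by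
  have h1 := h m
  have h2 := congrArg (starRingEnd ℂ) (h (-m))
  simp only [map_add, map_mul, hu, hv, neg_neg, Complex.conj_I, map_zero] at h2
  have h3 : u m = 0 := by linear_combination (h1 + h2) / 2
  refine ⟨h3, ?_⟩
  rw [h3, zero_add] at h1
  exact (mul_eq_zero.1 h1).resolve_left Complex.I_ne_zero

theorem map_real_apply {Y Z : Type*} [MeasurableSpace Y] [MeasurableSpace Z] {a : Measure Y}
    {φ : Y → Z} (hφ : Measurable φ) {s : Set Z} (hs : MeasurableSet s) :
    (a.map φ).real s = a.real (φ ⁻¹' s) := by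
  rw [measureReal_def, measureReal_def, Measure.map_apply hφ hs]

/-- Uniqueness: for `αβM² < 16π²` no nonzero measure is carried by one branch. -/
theorem eq_zero_of_carried_by_branch {ε : ℤ} (hε : ε * ε = 1) {α β M : ℝ} (hα : 0 < α)
    (hβ : 0 < β) (hM : 0 < M) (hlt : α * β * M ^ 2 < 16 * Real.pi ^ 2)
    {μ : ComplexMeasure Plane} (hμ : μ ∈ ACVanishing (hyperbola M) (latticeCross α β))
    (hB : ∀ s, MeasurableSet s → Disjoint s (branch ε M) → μ s = 0) : μ = 0 := by
  have hpi := Real.pi_pos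
  set γ : ℝ := α * β * M ^ 2 / (16 * Real.pi ^ 2) with hγ
  have hγ0 : 0 < γ := by positivity
  have hγ1 : γ < 1 := by rw [hγ, div_lt_one (by positivity)]; exact hlt
  have hℓ := measurable_branchCoord ε α
  have hφ := measurable_branchParam ε α β γ
  have hinter : ∀ E, MeasurableSet E → μ E = μ (E ∩ branch ε M) := by
    intro E hE
    rw [← inter_union_sdiff E (branch ε M), VectorMeasure.of_union
      (disjoint_sdiff_right.mono_left inter_subset_right)
      (hE.inter (measurableSet_branch ε M)) (hE.diff (measurableSet_branch ε M)),
      hB _ (hE.diff (measurableSet_branch ε M)) disjoint_sdiff_left, add_zero,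
      inter_union_sdiff]
  set ν : ComplexMeasure ℝ := μ.map (branchCoord ε α) with hν
  have hνE : ∀ E, MeasurableSet E → ν E = μ (branchCoord ε α ⁻¹' E ∩ branch ε M) := by
    intro E hE
    rw [hν, VectorMeasure.map_apply μ hℓ hE, hinter _ (hℓ hE)]
  have hμν : ∀ E, MeasurableSet E → μ E = ν (branchParam ε α β γ ⁻¹' E) := by
    intro E hE
    rw [hνE _ (hφ hE), hinter E hE]
    congr 1
    ext x
    simp only [mem_inter_iff, mem_preimage, and_congr_left_iff]
    intro hx
    rw [branchParam_branchCoord hε hα hβ hγ hx]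
  have hnull : ∀ E, MeasurableSet E → volume.restrict (Ioi 0) E = 0 → ν E = 0 := by
    intro E hE h0
    rw [hνE E hE]
    exact hμ.1.2 _ ((hℓ hE).inter (measurableSet_branch ε M))
      (arcLength_preimage_branchCoord hε hα hβ hγ hE h0)
  have hrenull := totalVariation_absolutelyContinuous (s := ComplexMeasure.re ν)
    (ρ := volume.restrict (Ioi 0)) fun E hE h0 => congrArg Complex.re (hnull E hE h0)
  have himnull := totalVariation_absolutelyContinuous (s := ComplexMeasure.im ν)
    (ρ := volume.restrict (Ioi 0)) fun E hE h0 => congrArg Complex.im (hnull E hE h0)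
  rw [SignedMeasure.totalVariation_absolutelyContinuous_iff] at hrenull himnull
  set p := (ComplexMeasure.re ν).toJordanDecomposition with hp
  set q := (ComplexMeasure.im ν).toJordanDecomposition with hq
  have hpre : ∀ E, MeasurableSet E → (ν E).re = p.posPart.real E - p.negPart.real E :=
    fun E hE => (ComplexMeasure.re ν).apply_eq_posPart_real_sub_negPart_real hE
  have hqim : ∀ E, MeasurableSet E → (ν E).im = q.posPart.real E - q.negPart.real E :=
    fun E hE => (ComplexMeasure.im ν).apply_eq_posPart_real_sub_negPart_real hE
  have hfour : ∀ ξ : Plane, ∀ k : ℝ → ℂ,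
      (∀ s, Complex.exp (Complex.I * (Real.pi : ℂ) *
        ((inner ℝ (branchParam ε α β γ s) ξ : ℝ) : ℂ)) = k s) →
      measureFourier μ ξ = ((∫ s, k s ∂p.posPart) - ∫ s, k s ∂p.negPart) +
        Complex.I * ((∫ s, k s ∂q.posPart) - ∫ s, k s ∂q.negPart) := by
    intro ξ k hk
    have hfm := measurable_fourierKernel ξ
    have := integral_complexMeasure_eq (μ := μ) (a := p.posPart.map (branchParam ε α β γ))
      (b := p.negPart.map (branchParam ε α β γ)) (c := q.posPart.map (branchParam ε α β γ))
      (d := q.negPart.map (branchParam ε α β γ))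
      (fun s hs => by
        rw [hμν s hs, hpre _ (hφ hs), map_real_apply hφ hs, map_real_apply hφ hs])
      (fun s hs => by
        rw [hμν s hs, hqim _ (hφ hs), map_real_apply hφ hs, map_real_apply hφ hs])
      hfm (fun x => (norm_fourierKernel x ξ).le)
    rw [measureFourier, this]
    simp only [integral_map hφ.aemeasurable hfm.aestronglyMeasurable, hk]
  have hzero : ∀ φ : ℝ → UnitAddCircle, (∀ m : ℤ, ∃ ξ ∈ latticeCross α β, ∀ s,
      Complex.exp (Complex.I * (Real.pi : ℂ) *
        ((inner ℝ (branchParam ε α β γ s) ξ : ℝ) : ℂ)) = fourier m (φ s)) → ∀ m : ℤ,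
      ∫ s, fourier m (φ s) ∂p.posPart = ∫ s, fourier m (φ s) ∂p.negPart ∧
      ∫ s, fourier m (φ s) ∂q.posPart = ∫ s, fourier m (φ s) ∂q.negPart := by
    intro φ h m
    have := eq_zero_of_add_I_mul_eq_zero
      (u := fun m => (∫ s, fourier m (φ s) ∂p.posPart) - ∫ s, fourier m (φ s) ∂p.negPart)
      (v := fun m => (∫ s, fourier m (φ s) ∂q.posPart) - ∫ s, fourier m (φ s) ∂q.negPart)
      (fun m => by simp only [map_sub, conj_integral_fourier])
      (fun m => by simp only [map_sub, conj_integral_fourier])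
      (fun m => by
        obtain ⟨ξ, hξ, hk⟩ := h m
        rw [← hfour ξ _ hk, hμ.2 ξ hξ]) m
    exact ⟨sub_eq_zero.1 this.1, sub_eq_zero.1 this.2⟩
  have hεm : ∀ m : ℤ, ε * (ε * m) = m := fun m => by rw [← mul_assoc, hε, one_mul]
  -- The lattice point of index `ε * m` is used so that the sign of the branch cancels and the
  -- character has frequency `m`.
  have h1 := hzero (fun s => (s : UnitAddCircle)) fun m =>
    ⟨_, fst_mem_latticeCross α β (ε * m), fun s => by
      rw [exp_inner_branchParam_fst ε hα β γ s (ε * m), hεm]⟩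
  have h2 := hzero (fun s => ((γ / s : ℝ) : UnitAddCircle)) fun m =>
    ⟨_, snd_mem_latticeCross α β (ε * m), fun s => by
      rw [exp_inner_branchParam_snd ε α hβ γ s (ε * m), hεm]⟩
  obtain ⟨hp1, hp2⟩ := eq_zero_of_integral_fourier_eq hγ0 hγ1 hrenull.1 hrenull.2
    p.mutuallySingular (fun m => (h1 m).1) (fun m => (h2 m).1)
  obtain ⟨hq1, hq2⟩ := eq_zero_of_integral_fourier_eq hγ0 hγ1 himnull.1 himnull.2
    q.mutuallySingular (fun m => (h1 m).2) (fun m => (h2 m).2)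
  ext E hE
  rw [hμν E hE]
  apply Complex.ext
  · rw [hpre _ (hφ hE), hp1, hp2]; simp
  · rw [hqim _ (hφ hE), hq1, hq2]; simp

/-- Existence: for `αβM² ≥ 16π²` some nonzero measure is carried by the branch. -/
theorem exists_carried_by_branch {ε : ℤ} (hε : ε * ε = 1) {α β M : ℝ} (hα : 0 < α)
    (hβ : 0 < β) (hle : 16 * Real.pi ^ 2 ≤ α * β * M ^ 2) :
    ∃ μ ∈ ACVanishing (hyperbola M) (latticeCross α β),
      (∀ s, MeasurableSet s → Disjoint s (branch ε M) → μ s = 0) ∧ μ ≠ 0 := by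
  have hpi := Real.pi_pos
  set γ : ℝ := α * β * M ^ 2 / (16 * Real.pi ^ 2) with hγ
  have hγ1 : 1 ≤ γ := by rw [hγ, one_le_div (by positivity)]; exact hle
  obtain ⟨a, b, ha, hb, hac, hbc, ha0, hb0, h1, h2⟩ := exists_integral_fourier_eq hγ1
  have hφ := measurable_branchParam ε α β γ
  have hℓ := measurable_branchCoord ε α
  set μ : ComplexMeasure Plane := smulMeasure (a.map (branchParam ε α β γ)) 1 -
    smulMeasure (b.map (branchParam ε α β γ)) 1 with hμ
  have hμE : ∀ E, MeasurableSet E → μ E =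
      ((a.real (branchParam ε α β γ ⁻¹' E) - b.real (branchParam ε α β γ ⁻¹' E) : ℝ) : ℂ) := by
    intro E hE
    rw [hμ, sub_apply, smulMeasure_apply _ _ hE, smulMeasure_apply _ _ hE, map_real_apply hφ hE,
      map_real_apply hφ hE]
    push_cast
    ring
  have hnull : ∀ E, MeasurableSet E →
      volume.restrict (Ioi 0) (branchParam ε α β γ ⁻¹' E) = 0 → μ E = 0 := by
    intro E hE h0
    rw [hμE E hE, measureReal_def, measureReal_def, hac h0, hbc h0]
    simp
  have hbranch : ∀ s, MeasurableSet s → Disjoint s (branch ε M) → μ s = 0 := by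
    intro s hs hd
    refine hnull s hs ?_
    rw [Measure.restrict_apply (hφ hs)]
    convert measure_empty (μ := volume)
    refine Set.eq_empty_of_forall_notMem fun t ht => ?_
    exact Set.disjoint_left.1 hd ht.1 (branchParam_mem hε hα hβ hγ ht.2)
  have hfour : ∀ ξ : Plane, ∀ k : ℝ → ℂ,
      (∀ s, Complex.exp (Complex.I * (Real.pi : ℂ) *
        ((inner ℝ (branchParam ε α β γ s) ξ : ℝ) : ℂ)) = k s) →
      ∫ s, k s ∂a = ∫ s, k s ∂b → measureFourier μ ξ = 0 := by
    intro ξ k hk hab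
    have hfm := measurable_fourierKernel ξ
    have := integral_complexMeasure_eq (μ := μ) (a := a.map (branchParam ε α β γ))
      (b := b.map (branchParam ε α β γ)) (c := 0) (d := 0)
      (fun s hs => by
        rw [hμE s hs, Complex.ofReal_re, map_real_apply hφ hs, map_real_apply hφ hs])
      (fun s hs => by rw [hμE s hs, Complex.ofReal_im]; simp)
      hfm (fun x => (norm_fourierKernel x ξ).le)
    rw [measureFourier, this]
    simp only [integral_map hφ.aemeasurable hfm.aestronglyMeasurable, hk, hab]
    simp
  refine ⟨μ, ⟨⟨fun s hs hd => hbranch s hs (hd.mono_right inter_subset_left),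
    fun s hs h0 => hnull s hs (volume_preimage_branchParam hε hα hβ hγ hs h0)⟩, fun ξ hξ => ?_⟩,
    hbranch, fun h0 => ?_⟩
  · rcases eq_of_mem_latticeCross hξ with ⟨m, rfl⟩ | ⟨n, rfl⟩
    · exact hfour _ _ (fun s => exp_inner_branchParam_fst ε hα β γ s m) (h1 _)
    · exact hfour _ _ (fun s => exp_inner_branchParam_snd ε α hβ γ s n) (h2 _)
  -- The arc with parameter in `(0, 1]` is charged by `a` but not by `b`, so no cancellation occurs
  -- there.
  · have hS := hμE (branchCoord ε α ⁻¹' Ioc 0 1) (hℓ measurableSet_Ioc)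
    have hpre : branchParam ε α β γ ⁻¹' (branchCoord ε α ⁻¹' Ioc 0 1) = Ioc 0 1 := by
      ext s
      simp only [mem_preimage, branchCoord_branchParam hε hα β γ s]
    rw [h0, hpre, measureReal_def b, hb0, ENNReal.toReal_zero, sub_zero, zero_apply, eq_comm,
      Complex.ofReal_eq_zero, measureReal_eq_zero_iff] at hS
    exact ha0 hS

theorem hyperbolaPos_eq_branch (M : ℝ) (hM : 0 < M) : hyperbolaPos M = branch 1 M := by
  have hc : 0 < M ^ 2 / (4 * Real.pi ^ 2) := by have := Real.pi_pos; positivity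
  ext x
  refine ⟨fun hx => ⟨hx.1, ?_⟩, fun hx => ⟨hx.1, ?_⟩⟩
  · simpa using hx.2.1
  · have h0 : 0 < x 0 := by simpa using hx.2
    refine ⟨h0, ?_⟩
    have h1 : x 0 * x 1 = M ^ 2 / (4 * Real.pi ^ 2) := hx.1
    exact (mul_pos_iff_of_pos_left h0).1 (h1 ▸ hc)

theorem hyperbolaNeg_eq_branch (M : ℝ) (hM : 0 < M) : hyperbolaNeg M = branch (-1) M := by
  have hc : 0 < M ^ 2 / (4 * Real.pi ^ 2) := by have := Real.pi_pos; positivity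
  rw [hyperbolaNeg, hyperbolaPos_eq_branch M hM]
  ext x
  constructor
  · rintro ⟨hx, hn⟩
    refine ⟨hx, ?_⟩
    have h1 : x 0 * x 1 = M ^ 2 / (4 * Real.pi ^ 2) := hx
    have h0 : x 0 ≠ 0 := by rintro h; rw [h, zero_mul] at h1; exact hc.ne h1
    have h2 : ¬ 0 < x 0 := fun h => hn ⟨hx, by simpa using h⟩
    have : x 0 < 0 := lt_of_le_of_ne (not_lt.1 h2) h0
    simpa using this
  · rintro ⟨hx, hn⟩
    refine ⟨hx, fun h => ?_⟩
    have h1 : x 0 < 0 := by simpa using hn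
    have h2 : 0 < x 0 := by simpa using h.2
    exact lt_asymm h1 h2

theorem carried_by_branch_iff {ε : ℤ} (hε : ε * ε = 1) {α β M : ℝ} (hα : 0 < α) (hβ : 0 < β)
    (hM : 0 < M) :
    (∀ μ ∈ ACVanishing (hyperbola M) (latticeCross α β),
      (∀ s, MeasurableSet s → Disjoint s (branch ε M) → μ s = 0) → μ = 0) ↔
      α * β * M ^ 2 < 16 * Real.pi ^ 2 := by
  constructor
  · intro h
    by_contra! hle
    obtain ⟨μ, hμ, hB, hne⟩ := exists_carried_by_branch hε hα hβ hle
    exact hne (h μ hμ hB)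
  · exact fun hlt μ hμ hB => eq_zero_of_carried_by_branch hε hα hβ hM hlt hμ hB

end KleinGordon

theorem mainTheorem7 (α β M : ℝ) (hα : 0 < α) (hβ : 0 < β) (hM : 0 < M) :
    ((∀ μ ∈ KleinGordon.ACVanishing (KleinGordon.hyperbola M) (KleinGordon.latticeCross α β),
      ∀ ν ∈ KleinGordon.ACVanishing (KleinGordon.hyperbola M) (KleinGordon.latticeCross α β),
        μ.restrict (KleinGordon.hyperbolaNeg M) = ν.restrict (KleinGordon.hyperbolaNeg M) →
          μ = ν) ↔
      α * β * M ^ 2 < 16 * Real.pi ^ 2) ∧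
    ((∀ μ ∈ KleinGordon.ACVanishing (KleinGordon.hyperbola M) (KleinGordon.latticeCross α β),
      ∀ ν ∈ KleinGordon.ACVanishing (KleinGordon.hyperbola M) (KleinGordon.latticeCross α β),
        μ.restrict (KleinGordon.hyperbolaPos M) = ν.restrict (KleinGordon.hyperbolaPos M) →
          μ = ν) ↔
      α * β * M ^ 2 < 16 * Real.pi ^ 2) := by
  have hcover : KleinGordon.hyperbola M ⊆ KleinGordon.hyperbolaPos M ∪ KleinGordon.hyperbolaNeg M :=
    fun x hx => (em (x ∈ KleinGordon.hyperbolaPos M)).imp id fun h => ⟨hx, h⟩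
  have hdisj : Disjoint (KleinGordon.hyperbolaPos M) (KleinGordon.hyperbolaNeg M) :=
    Set.disjoint_sdiff_right
  constructor
  -- Determination by the negative branch is a statement about measures carried by the positive one,
  -- and conversely.
  · rw [KleinGordon.determined_iff (KleinGordon.measurableSet_hyperbolaNeg M) hcover hdisj,
      KleinGordon.hyperbolaPos_eq_branch M hM]
    exact KleinGordon.carried_by_branch_iff (by norm_num) hα hβ hM
  · rw [KleinGordon.determined_iff (KleinGordon.measurableSet_hyperbolaPos M)
      (Set.union_comm _ _ ▸ hcover) hdisj.symm, KleinGordon.hyperbolaNeg_eq_branch M hM]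
    exact KleinGordon.carried_by_branch_iff (by norm_num) hα hβ hM
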